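/- An instance of Unique Games consists of a finite simple graph $G=(V,E)$ with $n=|V|$ vertices, a set of $k$ labels $[k]$, and, for every edge $(u,v)\in E$ (each edge listed once, in a fixed orientation), a permutation $\pi_{uv}$ of $[k]$; an assignment $x:V\to[k]$ satisfies the edge $(u,v)$ if $x_v=\pi_{uv}(x_u)$. The instance is $\alpha$-satisfiable if some assignment satisfies at least $\alpha|E|$ edges. Its SDP value is the minimum of $$\frac1{2|E|}\sum_{(u,v)\in E}\sum_{i\in[k]}\|u_i-v_{\pi_{uv}(i)}\|^2$$ over all families of vectors $u_i$ ($u\in V$, $i\in[k]$) in Euclidean spaces $\mathbb R^d$ of any dimension such that $\sum_{i}\|u_i\|^2=1$ for all $u$; $\langle u_i,u_j\rangle=0$ for all $u$ and $i\ne j$; $\langle u_i,v_j\rangle\ge 0$ for all $u,v$ and $i\neq j$; and $\|u_i-v_j\|^2\le\|u_i-w_l\|^2+\|w_l-v_j\|^2$ for all $u,v,w\in V$, $i,j,l\in[k]$. Theorem. There exist absolute constants $k_0\in\mathbb N$ and $C>0$ and a function $\eta:\mathbb N\to\mathbb R$ with $\eta(n)\to0$ as $n\to\infty$ such that the following holds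 for all $n$, all $k\ge k_0$ and all $\varepsilon\in(0,1]$. Let $\mathcal I_0$ be an arbitrary (not necessarily satisfiable) instance of Unique Games with $k$ labels on a graph $G=(V,E)$ with $n$ vertices and at least $Cn\max(\varepsilon^{-1},\log k)$ edges, let $E_\varepsilon\subseteq E$ be an arbitrary set of exactly $\varepsilon|E|$ edges, and let $\mathcal I$ be obtained from $\mathcal I_0$ by replacing the constraints on the edges of $E_\varepsilon$ by independent uniformly random permutations of $[k]$. Then, with probability at least $1-\eta(n)$, the SDP value of $\mathcal I$ is at least $\varepsilon/32$. On the other hand, if $0\le\delta<\varepsilon/32$, then the SDP value of every $(1-\delta)$-satisfiable instance (on any graph and with any number of labels) is at most $\delta$, and hence less than $\varepsilon/32$. Consequently, comparing the SDP value with $\varepsilon/32$ distinguishes, with probability $1-o(1)$, the semi-random instances $\mathcal I$ above from arbitrary $(1-\delta)$-satisfiable instances. -/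

import Mathlib

open Filter Topology
open scoped BigOperators

noncomputable section

/-- An instance of Unique Games on the vertex set `Fin n` with label set `Fin k`: a simple
constraint graph and one permutation of the labels for every edge. Every edge `{u, v}` with
`u < v` is listed once, oriented from its smaller endpoint `u = e.inf` to its larger endpoint
`v = e.sup`, and carries the constraint `x v = π (x u)`; read from `v` to `u`, the same constraint
is given by the inverse permutation. -/
structure UniqueGame (n k : ℕ) where
  graph : SimpleGraph (Fin n)
  perm : graph.edgeSet → Equiv.Perm (Fin k)

namespace UniqueGame

variable {n k : ℕ}

/-- The number of edges `|E|`. -/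
def numEdges (I : UniqueGame n k) : ℕ := I.graph.edgeSet.ncard

/-- The assignment `x` satisfies the constraint of the edge `e`. -/
def Satisfies (I : UniqueGame n k) (x : Fin n → Fin k) (e : I.graph.edgeSet) : Prop :=
  x (e : Sym2 (Fin n)).sup = I.perm e (x (e : Sym2 (Fin n)).inf)

/-- The instance is `α`-satisfiable: some assignment satisfies at least an `α` fraction of the
constraints. -/
def IsSatisfiable (I : UniqueGame n k) (α : ℝ) : Prop :=
  ∃ x : Fin n → Fin k, α * (I.numEdges : ℝ) ≤ ({e | I.Satisfies x e}.ncard : ℝ)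

open Classical in
/-- The instance obtained from `I` by replacing the constraint of every edge `e` in `F`
by the permutation `σ e`; all other constraints are kept. -/
def corrupt (I : UniqueGame n k) (F : Finset I.graph.edgeSet)
    (σ : F → Equiv.Perm (Fin k)) : UniqueGame n k where
  graph := I.graph
  perm e := if h : e ∈ F then σ ⟨e, h⟩ else I.perm e

/-- The constraints of the standard SDP on a family of vectors `x u i`, one for every vertex `u`
and every label `i`. -/
structure IsSDPFeasible {E : Type*} [NormedAddCommGroup E] [InnerProductSpace ℝ E]
    (x : Fin n → Fin k → E) : Prop where
  sum_sq : ∀ u, ∑ i, ‖x u i‖ ^ 2 = 1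
  orthogonal : ∀ u i j, i ≠ j → inner ℝ (x u i) (x u j) = 0
  nonneg : ∀ u v i j, i ≠ j → 0 ≤ inner ℝ (x u i) (x v j)
  triangle : ∀ u v w i j l,
    ‖x u i - x v j‖ ^ 2 ≤ ‖x u i - x w l‖ ^ 2 + ‖x w l - x v j‖ ^ 2

open Classical in
/-- The objective function of the standard SDP,
`1 / (2 |E|) * ∑_{(u, v) ∈ E} ∑_i ‖u_i - v_{π_{uv}(i)}‖²`. -/
def sdpObjective {E : Type*} [NormedAddCommGroup E] [InnerProductSpace ℝ E]
    (I : UniqueGame n k) (x : Fin n → Fin k → E) : ℝ :=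
  1 / (2 * (I.numEdges : ℝ)) * ∑ e : I.graph.edgeSet, ∑ i : Fin k,
    ‖x (e : Sym2 (Fin n)).inf i - x (e : Sym2 (Fin n)).sup (I.perm e i)‖ ^ 2

/-- The optimal value of the standard SDP: the infimum of the objective over all feasible families
of vectors in Euclidean spaces of all finite dimensions. -/
def sdpValue (I : UniqueGame n k) : ℝ :=
  sInf {t | ∃ (d : ℕ) (x : Fin n → Fin k → EuclideanSpace ℝ (Fin d)),
    IsSDPFeasible x ∧ t = I.sdpObjective x}

/-- The probability that the instance has property `P` after the constraints of the edges in `F`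
have been replaced by independent, uniformly random permutations of the labels (that is, by a
uniformly random function from `F` to the permutations). -/
def probCorrupt (I : UniqueGame n k) (F : Finset I.graph.edgeSet)
    (P : UniqueGame n k → Prop) : ℝ :=
  ((PMF.uniformOfFintype (F → Equiv.Perm (Fin k))).toOuterMeasure
    {σ | P (I.corrupt F σ)}).toReal

end UniqueGame

end

/-! A satisfiable instance has small value because of the integral solution, in which each vertex
puts its whole mass on its assigned label and a violated edge costs 2.

For the lower bound it suffices to look at the m = ε|E| ≥ Cn corrupted edges: outside an event of
probability `exp (-n)`, every normalized orthogonal family of vectors has total squared distance at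
least m/16 over them (`exists_card_hasCheapVectors_le`). Vectors become label sets by projecting
onto a Gaussian g and putting S_u = {i : ⟨u_i, g⟩² > τ}. If the vectors nearly agreed along the
constraints, then on average over g and τ the permutations would match about 7/8 of the mass. Random
permutations match only about |S_u||S_v|/k labels per edge. On average this is at most 2/π + 1/k,
since orthogonal vectors have independent projections and (E|N(0,1)|)² = 2/π. As 2/π < 7/8, the
distances cannot be small.

What remains is to bound the matched labels for all families (S_u) at once (`HasSmallDiscrepancy`).
There are 2^(kn) families but possibly only O(n) random edges, so the union bound must follow the
entropy a(1 + log(k/a)) of a set of size a. Each edge enters the exponential moment with a weight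
proportional to 1 + log(k/min); the moment stays at most 1 (`sum_exp_excess_le`), and the permitted
deviation, a small multiple of the entropies, pays for the union bound at vertices of large degree
(`card_exists_weightedExcess_gt_le`). Averaging over truncations of the family by set size then
removes the weights (`hasSmallDiscrepancy_of_weightedExcess_le`). Edges at low-degree vertices are
few and are discarded. -/

set_option linter.unusedSectionVars false

/-! ### Exponential moments of the matching count of a random permutation. -/

section Permutations

variable {α : Type*} [Fintype α] [DecidableEq α]

/-- The number of permutations that map the set `J` into the set `B`. -/
def numPermMapsTo (J B : Finset α) : ℕ :=
  (Finset.univ.filter fun π : Equiv.Perm α => ∀ i ∈ J, π i ∈ B).card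

theorem numPermMapsTo_insert_congr (J B : Finset α) {i i' : α} (hi : i ∉ J) (hi' : i' ∉ J) :
    numPermMapsTo (insert i J) B = numPermMapsTo (insert i' J) B := by
  unfold numPermMapsTo
  refine Finset.card_equiv (Equiv.mulRight (Equiv.swap i i')) fun π => ?_
  have h : ∀ j ∈ J, Equiv.swap i i' j = j := fun j hj =>
    Equiv.swap_apply_of_ne_of_ne (by rintro rfl; exact hi hj) (by rintro rfl; exact hi' hj)
  simp only [Finset.mem_filter, Finset.mem_univ, true_and, Finset.forall_mem_insert,
    Equiv.coe_mulRight, Equiv.Perm.mul_apply, Equiv.swap_apply_right]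
  refine and_congr_right fun _ => forall₂_congr fun j hj => ?_
  rw [h j hj]

theorem numPermMapsTo_insert (J B : Finset α) {i : α} (hi : i ∉ J) :
    ((Fintype.card α : ℝ) - J.card) * numPermMapsTo (insert i J) B =
      ((B.card : ℝ) - J.card) * numPermMapsTo J B := by
  -- Double counting of pairs (π, i') with π(J) ⊆ B, i' ∉ J and π i' ∈ B: each such π has exactly
  -- |B| - |J| choices of i'. By symmetry all i' contribute equally.
  have key : ∑ i' ∈ Jᶜ, (numPermMapsTo (insert i' J) B : ℝ) =
      ((B.card : ℝ) - J.card) * numPermMapsTo J B := by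
    have h1 : ∀ i' ∈ Jᶜ, (numPermMapsTo (insert i' J) B : ℝ) =
        ∑ π ∈ Finset.univ.filter (fun π : Equiv.Perm α => ∀ j ∈ J, π j ∈ B),
          if π i' ∈ B then (1 : ℝ) else 0 := by
      intro i' _
      rw [Finset.sum_boole, Finset.filter_filter]
      unfold numPermMapsTo
      congr 2
      ext π
      simp [and_comm]
    rw [Finset.sum_congr rfl h1, Finset.sum_comm, numPermMapsTo, mul_comm, ← nsmul_eq_mul,
      ← Finset.sum_const]
    refine Finset.sum_congr rfl fun π hπ => ?_
    rw [Finset.mem_filter] at hπ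
    rw [Finset.sum_boole]
    have h2 : ((Finset.univ.filter fun j => π j ∈ B).card : ℝ) = B.card := by
      congr 1
      exact Finset.card_equiv π (by simp)
    have h3 : (Finset.univ.filter fun j => π j ∈ B) =
        (Finset.filter (fun j => π j ∈ B) Jᶜ) ∪ J := by
      ext j
      by_cases hj : j ∈ J <;> simp [hj]
      exact hπ.2 j hj
    rw [h3, Finset.card_union_of_disjoint] at h2
    · push_cast at h2
      linarith
    · rw [Finset.disjoint_left]
      intro j hj
      simpa using (Finset.mem_filter.1 hj).1
  rw [← key, Finset.sum_congr rfl fun i' hi' => by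
    rw [numPermMapsTo_insert_congr J B (Finset.mem_compl.1 hi') hi], Finset.sum_const,
    nsmul_eq_mul, Finset.card_compl, Nat.cast_sub (Finset.card_le_univ J)]

/-- Negative dependence: each further element of J multiplies the count by (|B| - |J|)/(k - |J|) ≤
|B|/k, so the images behave no worse than independent uniform labels. -/
theorem numPermMapsTo_le [Nonempty α] (J B : Finset α) :
    (numPermMapsTo J B : ℝ) ≤
      ((B.card : ℝ) / Fintype.card α) ^ J.card * (Fintype.card α).factorial := by
  induction J using Finset.induction_on with
  | empty => simp [numPermMapsTo, Fintype.card_perm]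
  | insert i J hi ih =>
    have hk : (0 : ℝ) < Fintype.card α := by exact_mod_cast Fintype.card_pos
    have hJ : (J.card : ℝ) < Fintype.card α := by
      exact_mod_cast Finset.card_lt_univ_of_notMem hi
    have hB : (B.card : ℝ) ≤ Fintype.card α := by exact_mod_cast Finset.card_le_univ B
    have h := numPermMapsTo_insert J B hi
    have hN : (0 : ℝ) ≤ numPermMapsTo J B := by positivity
    have hmono : (numPermMapsTo (insert i J) B : ℝ) ≤
        (B.card : ℝ) / Fintype.card α * numPermMapsTo J B := by
      rw [div_mul_eq_mul_div, le_div_iff₀ hk]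
      have h4 : (0 : ℝ) ≤ J.card := by positivity
      have : ((Fintype.card α : ℝ) - J.card) *
          (numPermMapsTo (insert i J) B * Fintype.card α) ≤
          ((Fintype.card α : ℝ) - J.card) * (B.card * numPermMapsTo J B) := by
        rw [← mul_assoc, h]
        have : 0 ≤ ((J.card : ℝ) * (Fintype.card α - B.card)) * numPermMapsTo J B := by
          have := sub_nonneg.2 hB
          positivity
        nlinarith
      exact le_of_mul_le_mul_left this (by linarith)
    rw [Finset.card_insert_of_notMem hi, pow_succ, mul_right_comm]
    calc _ ≤ _ := hmono
      _ ≤ (B.card : ℝ) / Fintype.card α * _ := mul_le_mul_of_nonneg_left ih (by positivity)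
      _ = _ := by ring

/-- The number of elements of `A` that the permutation `π` maps into `B`. -/
def matched (π : Equiv.Perm α) (A B : Finset α) : ℕ := (A.filter fun i => π i ∈ B).card

/-- Expanding ∏ (1 + (e^l - 1)·1[π i ∈ B]) over subsets of A reduces the moment to the counts above
and gives the Poisson bound with mean |A||B|/k. -/
theorem sum_exp_matched_le [Nonempty α] (A B : Finset α) {l : ℝ} (hl : 0 ≤ l) :
    ∑ π : Equiv.Perm α, Real.exp (l * matched π A B) ≤
      (Fintype.card α).factorial *
        Real.exp ((A.card : ℝ) * B.card / Fintype.card α * (Real.exp l - 1)) := by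
  set z := Real.exp l - 1 with hz
  have hz0 : 0 ≤ z := by linarith [Real.one_le_exp hl]
  have h1 : ∀ π : Equiv.Perm α, Real.exp (l * matched π A B) =
      ∑ J ∈ A.powerset, z ^ J.card * if ∀ i ∈ J, π i ∈ B then (1 : ℝ) else 0 := by
    intro π
    have : Real.exp (l * matched π A B) = ∏ i ∈ A, ((if π i ∈ B then z else 0) + 1) := by
      rw [mul_comm, Real.exp_nat_mul, matched, ← Finset.prod_const, Finset.prod_filter]
      refine Finset.prod_congr rfl fun i _ => ?_
      split_ifs <;> simp [hz]
    rw [this, Finset.prod_add_one]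
    refine Finset.sum_congr rfl fun J _ => ?_
    rw [Finset.prod_ite_zero]
    split_ifs <;> simp
  have hb : (0 : ℝ) ≤ z * (B.card / Fintype.card α) := by positivity
  calc ∑ π : Equiv.Perm α, Real.exp (l * matched π A B)
      = ∑ J ∈ A.powerset, z ^ J.card * numPermMapsTo J B := by
        rw [Finset.sum_congr rfl fun π _ => h1 π, Finset.sum_comm]
        refine Finset.sum_congr rfl fun J _ => ?_
        rw [← Finset.mul_sum, Finset.sum_boole]
        rfl
    _ ≤ ∑ J ∈ A.powerset, (Fintype.card α).factorial * (z * (B.card / Fintype.card α)) ^ J.card := by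
        refine Finset.sum_le_sum fun J _ => ?_
        rw [mul_pow]
        calc _ ≤ z ^ J.card * _ := mul_le_mul_of_nonneg_left (numPermMapsTo_le J B) (by positivity)
          _ = _ := by ring
    _ = (Fintype.card α).factorial * (z * (B.card / Fintype.card α) + 1) ^ A.card := by
        rw [← Finset.mul_sum, ← Finset.prod_const (z * ((B.card : ℝ) / Fintype.card α) + 1),
          Finset.prod_add_one]
        simp
    _ ≤ _ := by
        refine mul_le_mul_of_nonneg_left ?_ (by positivity)
        calc _ ≤ Real.exp (z * (B.card / Fintype.card α)) ^ A.card :=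
              pow_le_pow_left₀ (by positivity) (Real.add_one_le_exp _) _
          _ = _ := by rw [← Real.exp_nat_mul]; congr 1; ring

end Permutations

/-- The logarithmic weight `1 + log (k / a)` of a set of `a` out of `k` labels
(and `0` for the empty set). -/
noncomputable def logWeight (k a : ℕ) : ℝ := if a = 0 then 0 else 1 + Real.log ((k : ℝ) / a)

theorem one_le_logWeight {k a : ℕ} (ha : a ≠ 0) (hak : a ≤ k) : 1 ≤ logWeight k a := by
  have ha' : (0 : ℝ) < a := by positivity
  have : (1 : ℝ) ≤ (k : ℝ) / a := by rw [one_le_div ha']; exact_mod_cast hak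
  simp only [logWeight, ha, if_false]
  linarith [Real.log_nonneg this]

theorem logWeight_nonneg {k a : ℕ} (hak : a ≤ k) : 0 ≤ logWeight k a := by
  by_cases ha : a = 0
  · simp [logWeight, ha]
  · linarith [one_le_logWeight ha hak]

/-- Here a/k = exp(1 - L) with L the logarithmic weight, so an exponent as large as l = κL still
leaves a factor exp(-L/2), which absorbs the extra L in e^l - 1 - l ≤ l² e^l. -/
theorem div_mul_exp_sub_le {k a : ℕ} (hak : a ≤ k) {κ l : ℝ} (hκ : 0 ≤ κ) (hκ' : κ ≤ 1 / 2)
    (hl : l = κ * logWeight k a) :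
    (a : ℝ) / k * (Real.exp l - 1 - l) ≤ 6 * κ * l := by
  by_cases ha : a = 0
  · simp [ha, hl, logWeight]
  have ha' : (0 : ℝ) < a := by positivity
  have hk' : (0 : ℝ) < k := lt_of_lt_of_le ha' (by exact_mod_cast hak)
  set L := logWeight k a with hL
  have hL1 : 1 ≤ L := one_le_logWeight ha hak
  have hr : (a : ℝ) / k = Real.exp (1 - L) := by
    rw [hL, logWeight, if_neg ha, sub_add_cancel_left, ← Real.log_inv, inv_div,
      Real.exp_log (by positivity)]
  have hl0 : 0 ≤ l := by rw [hl]; positivity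
  have h1 : Real.exp l - 1 ≤ l * Real.exp l := by
    have := mul_le_mul_of_nonneg_right (Real.one_sub_le_exp_neg l) (Real.exp_pos l).le
    rw [← Real.exp_add, neg_add_cancel, Real.exp_zero] at this
    linarith
  have h2 : Real.exp l - 1 - l ≤ l * (l * Real.exp l) := by
    have := mul_le_mul_of_nonneg_left h1 hl0
    nlinarith
  have h3 : L ≤ 2 * Real.exp (L / 2) := by linarith [Real.add_one_le_exp (L / 2)]
  have h4 : Real.exp (1 - L) * Real.exp l ≤ 3 * Real.exp (-(L / 2)) := by
    have : Real.exp (1 - L) * Real.exp l ≤ Real.exp 1 * Real.exp (-(L / 2)) := by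
      rw [← Real.exp_add, ← Real.exp_add, Real.exp_le_exp, hl]
      nlinarith
    refine this.trans (mul_le_mul_of_nonneg_right ?_ (Real.exp_pos _).le)
    linarith [Real.exp_one_lt_d9]
  have h5 : L * Real.exp (-(L / 2)) ≤ 2 := by
    have := mul_le_mul_of_nonneg_right h3 (Real.exp_pos (-(L / 2))).le
    rwa [mul_assoc, ← Real.exp_add, add_neg_cancel, Real.exp_zero, mul_one] at this
  rw [hr]
  calc Real.exp (1 - L) * (Real.exp l - 1 - l) ≤ Real.exp (1 - L) * (l * (l * Real.exp l)) :=
        mul_le_mul_of_nonneg_left h2 (Real.exp_pos _).le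
    _ = l * l * (Real.exp (1 - L) * Real.exp l) := by ring
    _ ≤ l * l * (3 * Real.exp (-(L / 2))) := mul_le_mul_of_nonneg_left h4 (by positivity)
    _ = 3 * κ * l * (L * Real.exp (-(L / 2))) := by nth_rw 2 [hl]; ring
    _ ≤ 3 * κ * l * 2 := mul_le_mul_of_nonneg_left h5 (by positivity)
    _ = 6 * κ * l := by ring

/-! ### Discrepancy of random permutations, uniformly over families of label sets. -/

section Discrepancy

variable {α : Type*} [Fintype α] [DecidableEq α]

/-- The excess of the number of matched labels over its expectation plus `δ` times the average
size of the two sets. -/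
noncomputable def excess (δ : ℝ) (π : Equiv.Perm α) (A B : Finset α) : ℝ :=
  matched π A B - (A.card : ℝ) * B.card / Fintype.card α - δ * (((A.card : ℝ) + B.card) / 2)

/-- The weight with which the excess of a pair of sets enters the exponential moment. -/
noncomputable def pairWeight (δ : ℝ) (A B : Finset α) : ℝ :=
  δ / 12 * logWeight (Fintype.card α) (min A.card B.card)

/-- An upper bound for the logarithm of the number of sets of the same size as `A`. -/
noncomputable def setEntropy (A : Finset α) : ℝ :=
  (A.card : ℝ) * logWeight (Fintype.card α) A.card

theorem setEntropy_nonneg (A : Finset α) : 0 ≤ setEntropy A :=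
  mul_nonneg (by positivity) (logWeight_nonneg (Finset.card_le_univ A))

/-- The second-order term of the Poisson bound is at most 6 · (δ/12) · l · max(|A|, |B|), which the
slack δ(|A| + |B|)/2 in the excess cancels; this fixes the 12. -/
theorem sum_exp_excess_le [Nonempty α] {δ : ℝ} (hδ : 0 ≤ δ) (hδ' : δ ≤ 1) (A B : Finset α) :
    ∑ π : Equiv.Perm α, Real.exp (pairWeight δ A B * excess δ π A B) ≤
      (Fintype.card α).factorial := by
  have hmin : min A.card B.card ≤ Fintype.card α :=
    (min_le_left _ _).trans (Finset.card_le_univ A)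
  set l := pairWeight δ A B with hl
  have hl0 : 0 ≤ l := mul_nonneg (by positivity) (logWeight_nonneg hmin)
  have hkey := div_mul_exp_sub_le hmin (by positivity : 0 ≤ δ / 12) (by linarith) (l := l) rfl
  set a : ℝ := (A.card : ℝ) with ha
  set b : ℝ := (B.card : ℝ) with hb
  have ha0 : 0 ≤ a := by positivity
  have hb0 : 0 ≤ b := by positivity
  have hprod : a * b = ((min A.card B.card : ℕ) : ℝ) * max a b := by
    rw [Nat.cast_min, min_mul_max]
  have hmain : a * b / Fintype.card α * (Real.exp l - 1 - l) ≤ l * (δ * ((a + b) / 2)) := by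
    calc a * b / Fintype.card α * (Real.exp l - 1 - l)
        = max a b * (((min A.card B.card : ℕ) : ℝ) / Fintype.card α * (Real.exp l - 1 - l)) := by
          rw [hprod]; ring
      _ ≤ max a b * (6 * (δ / 12) * l) := mul_le_mul_of_nonneg_left hkey (by positivity)
      _ ≤ (a + b) * (6 * (δ / 12) * l) :=
          mul_le_mul_of_nonneg_right (max_le_add_of_nonneg ha0 hb0) (by positivity)
      _ = _ := by ring
  calc ∑ π : Equiv.Perm α, Real.exp (l * excess δ π A B)
      = Real.exp (-(l * (a * b / Fintype.card α)) - l * (δ * ((a + b) / 2))) *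
          ∑ π : Equiv.Perm α, Real.exp (l * matched π A B) := by
        rw [Finset.mul_sum]
        refine Finset.sum_congr rfl fun π _ => ?_
        rw [← Real.exp_add, excess]
        congr 1
        ring
    _ ≤ Real.exp (-(l * (a * b / Fintype.card α)) - l * (δ * ((a + b) / 2))) *
          ((Fintype.card α).factorial * Real.exp (a * b / Fintype.card α * (Real.exp l - 1))) :=
        mul_le_mul_of_nonneg_left (sum_exp_matched_le A B hl0) (Real.exp_pos _).le
    _ = (Fintype.card α).factorial * Real.exp (a * b / Fintype.card α * (Real.exp l - 1 - l) -
          l * (δ * ((a + b) / 2))) := by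
        rw [mul_left_comm, ← Real.exp_add]
        congr 2
        ring
    _ ≤ (Fintype.card α).factorial * 1 := by
        refine mul_le_mul_of_nonneg_left (Real.exp_le_one_iff.2 ?_) (by positivity)
        linarith
    _ = _ := mul_one _

/-- One copy of the entropy pays for the number of sets of size a; the other is at least a and makes
the sum over a geometric. -/
theorem sum_exp_neg_setEntropy_le [Nonempty α] :
    ∑ A : Finset α, Real.exp (-(2 * setEntropy A)) ≤ 2 := by
  set k := Fintype.card α with hk
  have hk0 : (0 : ℝ) < k := by rw [hk]; exact_mod_cast Fintype.card_pos
  have h1 : ∀ a ∈ Finset.range (k + 1), (k.choose a : ℝ) *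
      Real.exp (-(2 * (a * logWeight k a))) ≤ (1 / 2) ^ a := by
    intro a ha
    rw [Finset.mem_range, Nat.lt_succ_iff] at ha
    rcases Nat.eq_zero_or_pos a with rfl | hpos
    · simp
    have ha0 : (0 : ℝ) < a := by positivity
    have hL : Real.exp (-(a * logWeight k a)) = ((a : ℝ) / k) ^ a * Real.exp (-a) := by
      rw [logWeight, if_neg hpos.ne', mul_add, neg_add, Real.exp_add, mul_one, mul_comm,
        ← mul_neg, ← Real.log_inv, inv_div, Real.exp_nat_mul, Real.exp_log (by positivity)]
    have hL1 : Real.exp (-(a * logWeight k a)) ≤ (1 / 2) ^ a := by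
      have : Real.exp (-1 : ℝ) ≤ 1 / 2 := by
        rw [Real.exp_neg, one_div]
        exact inv_anti₀ (by norm_num) (by linarith [Real.exp_one_gt_d9])
      calc Real.exp (-(a * logWeight k a)) ≤ Real.exp (a * (-1)) := by
            rw [Real.exp_le_exp]
            nlinarith [one_le_logWeight hpos.ne' ha]
        _ = Real.exp (-1) ^ a := Real.exp_nat_mul _ _
        _ ≤ _ := pow_le_pow_left₀ (Real.exp_pos _).le this _
    have hchoose : (k.choose a : ℝ) * Real.exp (-(a * logWeight k a)) ≤ 1 := by
      have h2 : (k.choose a : ℝ) ≤ (k : ℝ) ^ a / a.factorial := Nat.choose_le_pow_div a k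
      have h3 : (a : ℝ) ^ a / a.factorial ≤ Real.exp a := Real.pow_div_factorial_le_exp _ ha0.le a
      rw [hL]
      calc (k.choose a : ℝ) * (((a : ℝ) / k) ^ a * Real.exp (-a))
          ≤ (k : ℝ) ^ a / a.factorial * (((a : ℝ) / k) ^ a * Real.exp (-a)) :=
            mul_le_mul_of_nonneg_right h2 (by positivity)
        _ = (a : ℝ) ^ a / a.factorial * Real.exp (-a) := by
            rw [div_pow]; field_simp
        _ ≤ Real.exp a * Real.exp (-a) := mul_le_mul_of_nonneg_right h3 (Real.exp_pos _).le
        _ = 1 := by rw [← Real.exp_add, add_neg_cancel, Real.exp_zero]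
    calc (k.choose a : ℝ) * Real.exp (-(2 * (a * logWeight k a)))
        = (k.choose a : ℝ) * Real.exp (-(a * logWeight k a)) *
            Real.exp (-(a * logWeight k a)) := by
          rw [mul_assoc, ← Real.exp_add]; congr 2; ring
      _ ≤ 1 * (1 / 2) ^ a := mul_le_mul hchoose hL1 (Real.exp_pos _).le zero_le_one
      _ = _ := one_mul _
  calc ∑ A : Finset α, Real.exp (-(2 * setEntropy A))
      = ∑ a ∈ Finset.range (k + 1), k.choose a • Real.exp (-(2 * (a * logWeight k a))) := by
        rw [← Finset.powerset_univ, hk, ← Finset.card_univ]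
        exact Finset.sum_powerset_apply_card
          (fun a : ℕ => Real.exp (-(2 * (a * logWeight (Finset.univ : Finset α).card a))))
    _ ≤ ∑ a ∈ Finset.range (k + 1), (1 / 2 : ℝ) ^ a :=
        Finset.sum_le_sum fun a ha => by rw [nsmul_eq_mul]; exact h1 a ha
    _ ≤ ∑' a : ℕ, (1 / 2 : ℝ) ^ a :=
        summable_geometric_two.sum_le_tsum _ fun _ _ => by positivity
    _ = 2 := tsum_geometric_two

variable {ι V : Type*} [Fintype ι] [Fintype V] [DecidableEq ι] [DecidableEq V]

/-- The degree of a vertex of the multigraph with edges `s e - t e`. -/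
def multiDegree (s t : ι → V) (u : V) : ℕ :=
  (Finset.univ.filter fun e => s e = u).card + (Finset.univ.filter fun e => t e = u).card

theorem sum_multiDegree_mul (s t : ι → V) (f : V → ℝ) :
    ∑ u, (multiDegree s t u : ℝ) * f u = ∑ e, (f (s e) + f (t e)) := by
  have h : ∀ r : ι → V, ∑ u, ((Finset.univ.filter fun e => r e = u).card : ℝ) * f u =
      ∑ e, f (r e) := by
    intro r
    rw [← Finset.sum_fiberwise Finset.univ r]
    refine Finset.sum_congr rfl fun u _ => ?_
    rw [← nsmul_eq_mul, ← Finset.sum_const]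
    exact Finset.sum_congr rfl fun e he => by rw [(Finset.mem_filter.1 he).2]
  simp only [multiDegree, Nat.cast_add, add_mul, Finset.sum_add_distrib, h]

/-- The total weighted excess of a family of label sets. -/
noncomputable def weightedExcess (δ : ℝ) (s t : ι → V) (σ : ι → Equiv.Perm α)
    (S : V → Finset α) : ℝ :=
  ∑ e, pairWeight δ (S (s e)) (S (t e)) * excess δ (σ e) (S (s e)) (S (t e))

theorem card_weightedExcess_gt_le [Nonempty α] {δ : ℝ} (hδ : 0 ≤ δ) (hδ' : δ ≤ 1)
    (s t : ι → V) (S : V → Finset α) (R : ℝ) :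
    ((Finset.univ.filter fun σ : ι → Equiv.Perm α => R < weightedExcess δ s t σ S).card : ℝ) ≤
      Real.exp (-R) * ((Fintype.card α).factorial : ℝ) ^ Fintype.card ι := by
  calc ((Finset.univ.filter fun σ : ι → Equiv.Perm α => R < weightedExcess δ s t σ S).card : ℝ)
      = ∑ σ : ι → Equiv.Perm α, if R < weightedExcess δ s t σ S then (1 : ℝ) else 0 := by
        rw [Finset.sum_boole]
    _ ≤ ∑ σ : ι → Equiv.Perm α, Real.exp (-R) * Real.exp (weightedExcess δ s t σ S) := by
        refine Finset.sum_le_sum fun σ _ => ?_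
        split_ifs with h
        · rw [← Real.exp_add]
          exact Real.one_le_exp (by linarith)
        · positivity
    _ = Real.exp (-R) * ∏ e, ∑ π : Equiv.Perm α, Real.exp
          (pairWeight δ (S (s e)) (S (t e)) * excess δ π (S (s e)) (S (t e))) := by
        rw [← Finset.mul_sum, Finset.prod_univ_sum, Fintype.piFinset_univ]
        simp only [weightedExcess, Real.exp_sum]
    _ ≤ Real.exp (-R) * ∏ _e : ι, ((Fintype.card α).factorial : ℝ) := by
        refine mul_le_mul_of_nonneg_left (Finset.prod_le_prod (fun e _ => ?_) fun e _ =>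
          sum_exp_excess_le hδ hδ' _ _) (Real.exp_pos _).le
        exact Finset.sum_nonneg fun π _ => (Real.exp_pos _).le
    _ = _ := by rw [Finset.prod_const, Finset.card_univ]

/-- A family of label sets that is empty at the vertices of degree less than `D`. -/
def IsSupportedOnDegree (s t : ι → V) (D : ℕ) (S : V → Finset α) : Prop :=
  ∀ u, (S u).Nonempty → D ≤ multiDegree s t u

/-- A vertex of degree at least D collects β · D ≥ 2 copies of its entropy from its edges, so the
union bound factorizes over vertices, each factor being at most 2. -/
theorem card_exists_weightedExcess_gt_le [Nonempty α] {δ β θ : ℝ} {D : ℕ} (hδ : 0 ≤ δ)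
    (hδ' : δ ≤ 1) (hβ : 0 ≤ β) (hD : 2 ≤ β * D) (s t : ι → V) :
    (Nat.card {σ : ι → Equiv.Perm α // ∃ S : V → Finset α, IsSupportedOnDegree s t D S ∧
      β * ∑ e, (setEntropy (S (s e)) + setEntropy (S (t e))) + θ * Fintype.card ι <
        weightedExcess δ s t σ S} : ℝ) ≤
      2 ^ Fintype.card V * Real.exp (-(θ * Fintype.card ι)) *
        ((Fintype.card α).factorial : ℝ) ^ Fintype.card ι := by
  classical
  set N := ((Fintype.card α).factorial : ℝ) ^ Fintype.card ι
  set R : (V → Finset α) → ℝ := fun S =>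
    β * ∑ e, (setEntropy (S (s e)) + setEntropy (S (t e))) + θ * Fintype.card ι
  have hR : ∀ S : V → Finset α, IsSupportedOnDegree s t D S →
      Real.exp (-R S) ≤ Real.exp (-(θ * Fintype.card ι)) *
        ∏ u, Real.exp (-(2 * setEntropy (S u))) := by
    intro S hS
    rw [← Real.exp_sum, ← Real.exp_add, Real.exp_le_exp, Finset.sum_neg_distrib]
    have : ∑ u, 2 * setEntropy (S u) ≤ β * ∑ e, (setEntropy (S (s e)) + setEntropy (S (t e))) := by
      rw [← sum_multiDegree_mul s t fun u => setEntropy (S u), Finset.mul_sum]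
      refine Finset.sum_le_sum fun u _ => ?_
      rcases (S u).eq_empty_or_nonempty with h | h
      · simp [h, setEntropy]
      · rw [← mul_assoc]
        refine mul_le_mul_of_nonneg_right (hD.trans ?_) (setEntropy_nonneg _)
        exact mul_le_mul_of_nonneg_left (by exact_mod_cast hS u h) hβ
    simp only [R]
    linarith
  calc _ = ((Finset.univ.filter fun σ : ι → Equiv.Perm α => ∃ S : V → Finset α,
        IsSupportedOnDegree s t D S ∧ R S < weightedExcess δ s t σ S).card : ℝ) := by
        rw [Nat.card_eq_fintype_card, Fintype.card_subtype]
    _ ≤ ((((Finset.univ : Finset (V → Finset α)).filter (IsSupportedOnDegree s t D)).biUnion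
          fun S => Finset.univ.filter fun σ : ι → Equiv.Perm α =>
            R S < weightedExcess δ s t σ S).card : ℝ) := by
        refine Nat.cast_le.2 (Finset.card_le_card fun σ hσ => ?_)
        obtain ⟨S, hS, hS'⟩ := (Finset.mem_filter.1 hσ).2
        simp only [Finset.mem_biUnion, Finset.mem_filter, Finset.mem_univ, true_and]
        exact ⟨S, hS, hS'⟩
    _ ≤ ∑ S ∈ (Finset.univ : Finset (V → Finset α)).filter (IsSupportedOnDegree s t D),
          ((Finset.univ.filter fun σ : ι → Equiv.Perm α =>
            R S < weightedExcess δ s t σ S).card : ℝ) := by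
        exact_mod_cast Finset.card_biUnion_le
    _ ≤ ∑ S ∈ (Finset.univ : Finset (V → Finset α)).filter (IsSupportedOnDegree s t D),
          Real.exp (-(θ * Fintype.card ι)) * (∏ u, Real.exp (-(2 * setEntropy (S u)))) * N := by
        refine Finset.sum_le_sum fun S hS => ?_
        refine (card_weightedExcess_gt_le hδ hδ' s t S (R S)).trans ?_
        exact mul_le_mul_of_nonneg_right (hR S (Finset.mem_filter.1 hS).2) (by positivity)
    _ ≤ ∑ S : V → Finset α,
          Real.exp (-(θ * Fintype.card ι)) * (∏ u, Real.exp (-(2 * setEntropy (S u)))) * N :=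
        Finset.sum_le_sum_of_subset_of_nonneg (Finset.filter_subset _ _) fun S _ _ => by positivity
    _ = Real.exp (-(θ * Fintype.card ι)) *
          (∏ _u : V, ∑ A : Finset α, Real.exp (-(2 * setEntropy A))) * N := by
        rw [Finset.prod_univ_sum, Fintype.piFinset_univ, Finset.mul_sum, Finset.sum_mul]
    _ ≤ Real.exp (-(θ * Fintype.card ι)) * (∏ _u : V, 2) * N := by
        gcongr with u
        exact sum_exp_neg_setEntropy_le
    _ = _ := by rw [Finset.prod_const, Finset.card_univ]; ring

/-- Telescoping, with the conventions `logWeight k 0 = 0` and `0⁻¹ = 0` making the lower end vanish.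
-/
theorem sum_inv_logWeight_sub {k m : ℕ} (hm : m ≤ k) (c : ℝ) :
    ∑ i ∈ Finset.range k, ((logWeight k (i + 1))⁻¹ - (logWeight k i)⁻¹) *
      (if i < m then c else 0) = c * (logWeight k m)⁻¹ := by
  simp only [mul_ite, mul_zero]
  rw [← Finset.sum_filter]
  have : (Finset.range k).filter (fun i => i < m) = Finset.range m := by
    ext i
    simp only [Finset.mem_filter, Finset.mem_range]
    omega
  rw [this, ← Finset.sum_mul, Finset.sum_range_sub fun i => (logWeight k i)⁻¹]
  simp [logWeight, mul_comm]

theorem inv_logWeight_mono {k i : ℕ} (hi : i < k) :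
    0 ≤ (logWeight k (i + 1))⁻¹ - (logWeight k i)⁻¹ := by
  rw [sub_nonneg]
  rcases Nat.eq_zero_or_pos i with rfl | hpos
  · simpa [logWeight] using logWeight_nonneg (k := k) (a := 0 + 1) (by omega)
  have hi' : (0 : ℝ) < i := by exact_mod_cast hpos
  refine inv_anti₀ (zero_lt_one.trans_le (one_le_logWeight (by omega) (by omega))) ?_
  rw [logWeight, logWeight, if_neg (by omega), if_neg hpos.ne']
  have hk : (0 : ℝ) < k := by exact_mod_cast (Nat.zero_le i).trans_lt hi
  gcongr
  simp

/-- The members with more than `i` elements of a family of label sets. -/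
def largeMembers (S : V → Finset α) (i : ℕ) (u : V) : Finset α := if i < (S u).card then S u else ∅

/-- For every family of label sets supported on the vertices of degree at least `D`, the number of
matched pairs is not much larger than expected. -/
def HasSmallDiscrepancy (s t : ι → V) (D : ℕ) (γ θ : ℝ) (σ : ι → Equiv.Perm α) : Prop :=
  ∀ S : V → Finset α, IsSupportedOnDegree s t D S →
    ∑ e, (matched (σ e) (S (s e)) (S (t e)) : ℝ) ≤
      ∑ e, ((S (s e)).card : ℝ) * (S (t e)).card / Fintype.card α +
        γ * ∑ e, (((S (s e)).card : ℝ) + (S (t e)).card) + θ * Fintype.card ι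

/-- The weighted bounds for all truncations are averaged with weights w i = 1/L(i+1) - 1/L(i). An
edge survives truncation while i < min(|A|, |B|), so it collects 1/L(min), cancelling its weight; a
vertex collects 1/L(|S u|), turning its entropy into |S u|. -/
theorem hasSmallDiscrepancy_of_weightedExcess_le [Nonempty α] {δ β θ : ℝ} {D : ℕ} (hδ : 0 < δ)
    (s t : ι → V) (σ : ι → Equiv.Perm α)
    (h : ∀ S : V → Finset α, IsSupportedOnDegree s t D S → weightedExcess δ s t σ S ≤
      β * ∑ e, (setEntropy (S (s e)) + setEntropy (S (t e))) + θ * Fintype.card ι) :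
    HasSmallDiscrepancy s t D (δ / 2 + 12 / δ * β) (12 / δ * θ) σ := by
  intro S hS
  set k := Fintype.card α with hk
  have hk0 : 0 < k := Fintype.card_pos
  set w : ℕ → ℝ := fun i => (logWeight k (i + 1))⁻¹ - (logWeight k i)⁻¹ with hw
  have hw0 : ∀ i ∈ Finset.range k, 0 ≤ w i := fun i hi => inv_logWeight_mono (Finset.mem_range.1 hi)
  have hcard : ∀ u, (S u).card ≤ k := fun u => Finset.card_le_univ _
  -- The total is 1/L(k), and L(k) = 1 + log 1 = 1.
  have hw1 : ∑ i ∈ Finset.range k, w i = 1 := by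
    have := sum_inv_logWeight_sub (le_refl k) 1
    rw [one_mul, Finset.sum_congr rfl fun i hi => by
      rw [if_pos (Finset.mem_range.1 hi), mul_one]] at this
    rw [this, logWeight, if_neg hk0.ne', div_self (by positivity), Real.log_one]
    norm_num
  have hlarge : ∀ i, weightedExcess δ s t σ (largeMembers S i) ≤
      β * ∑ e, (setEntropy (largeMembers S i (s e)) + setEntropy (largeMembers S i (t e))) +
        θ * Fintype.card ι := by
    refine fun i => h _ fun u hu => hS u ?_
    unfold largeMembers at hu
    split_ifs at hu
    · exact hu
    · simp at hu
  have hsum := Finset.sum_le_sum fun i hi => mul_le_mul_of_nonneg_left (hlarge i) (hw0 i hi)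
  have hentropy : ∀ u, ∑ i ∈ Finset.range k, w i * setEntropy (largeMembers S i u) =
      (S u).card := by
    intro u
    have h1 : ∀ i, setEntropy (largeMembers S i u) =
        if i < (S u).card then setEntropy (S u) else 0 := by
      intro i
      unfold largeMembers
      split_ifs <;> simp [setEntropy]
    simp only [h1, hw]
    rw [sum_inv_logWeight_sub (hcard u), setEntropy, ← hk]
    rcases Nat.eq_zero_or_pos (S u).card with h0 | h0
    · simp [h0]
    · rw [mul_inv_cancel_right₀]
      exact (zero_lt_one.trans_le (one_le_logWeight h0.ne' (hcard u))).ne'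
  have hedge : ∀ e, δ / 12 * (matched (σ e) (S (s e)) (S (t e)) -
        ((S (s e)).card : ℝ) * (S (t e)).card / k -
        δ * ((((S (s e)).card : ℝ) + (S (t e)).card) / 2)) ≤
      ∑ i ∈ Finset.range k, w i * (pairWeight δ (largeMembers S i (s e)) (largeMembers S i (t e)) *
        excess δ (σ e) (largeMembers S i (s e)) (largeMembers S i (t e))) := by
    intro e
    set A := S (s e) with hA
    set B := S (t e) with hB
    have hm : min A.card B.card ≤ k := (min_le_left _ _).trans (hcard _)
    have h1 : ∀ i, pairWeight δ (largeMembers S i (s e)) (largeMembers S i (t e)) *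
        excess δ (σ e) (largeMembers S i (s e)) (largeMembers S i (t e)) =
        if i < min A.card B.card then pairWeight δ A B * excess δ (σ e) A B else 0 := by
      intro i
      unfold largeMembers
      rw [← hA, ← hB]
      by_cases ha : i < A.card <;> by_cases hb : i < B.card <;>
        simp [ha, hb, pairWeight, logWeight]
    simp only [h1, hw]
    rw [sum_inv_logWeight_sub hm]
    -- If one set is empty the right side is 0 and the left side is nonpositive; otherwise the two
    -- sides are equal.
    rcases Nat.eq_zero_or_pos (min A.card B.card) with h0 | h0
    · have hmatch : matched (σ e) A B = 0 := by
        rcases Nat.min_eq_zero_iff.1 h0 with h | h <;> rw [Finset.card_eq_zero] at h <;>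
          simp [matched, h]
      have : logWeight k 0 = 0 := by simp [logWeight]
      rw [hmatch, h0, this, inv_zero, mul_zero]
      refine mul_nonpos_of_nonneg_of_nonpos (by positivity) ?_
      have h2 : 0 ≤ (A.card : ℝ) * B.card / k := by positivity
      have h3 : 0 ≤ δ * (((A.card : ℝ) + B.card) / 2) := by positivity
      push_cast
      linarith
    · have hne : logWeight k (min A.card B.card) ≠ 0 :=
        (zero_lt_one.trans_le (one_le_logWeight h0.ne' hm)).ne'
      rw [pairWeight, excess, ← hk]
      refine le_of_eq ?_
      field_simp
  have hleft : δ / 12 * (∑ e, (matched (σ e) (S (s e)) (S (t e)) : ℝ) -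
      ∑ e, ((S (s e)).card : ℝ) * (S (t e)).card / k -
      δ / 2 * ∑ e, (((S (s e)).card : ℝ) + (S (t e)).card)) ≤
      ∑ i ∈ Finset.range k, w i * weightedExcess δ s t σ (largeMembers S i) := by
    simp only [weightedExcess, Finset.mul_sum]
    rw [Finset.sum_comm]
    refine le_trans (le_of_eq ?_) (Finset.sum_le_sum fun e _ => hedge e)
    rw [← Finset.sum_sub_distrib, ← Finset.sum_sub_distrib, Finset.mul_sum]
    refine Finset.sum_congr rfl fun e _ => ?_
    ring
  have hright : ∑ i ∈ Finset.range k, w i * (β * ∑ e, (setEntropy (largeMembers S i (s e)) +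
      setEntropy (largeMembers S i (t e))) + θ * Fintype.card ι) =
      β * ∑ e, (((S (s e)).card : ℝ) + (S (t e)).card) + θ * Fintype.card ι := by
    simp only [mul_add, Finset.sum_add_distrib]
    rw [← Finset.sum_mul, hw1, one_mul]
    congr 1
    simp only [mul_left_comm _ β, ← Finset.mul_sum]
    rw [← mul_add]
    simp only [Finset.mul_sum, ← Finset.sum_add_distrib]
    rw [Finset.sum_comm]
    simp only [mul_add, Finset.sum_add_distrib, ← Finset.mul_sum, hentropy]
  have hfinal := hleft.trans (hsum.trans_eq hright)
  have h12 : 0 < 12 / δ := by positivity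
  have hmul := mul_le_mul_of_nonneg_left hfinal h12.le
  rw [← mul_assoc, div_mul_div_cancel₀' (by norm_num : (12 : ℝ) ≠ 0), div_self hδ.ne', one_mul] at hmul
  linarith

theorem card_not_hasSmallDiscrepancy_le [Nonempty α] {δ β θ : ℝ} {D : ℕ} (hδ : 0 < δ)
    (hδ' : δ ≤ 1) (hβ : 0 ≤ β) (hD : 2 ≤ β * D) (s t : ι → V) :
    (Nat.card {σ : ι → Equiv.Perm α //
      ¬ HasSmallDiscrepancy s t D (δ / 2 + 12 / δ * β) (12 / δ * θ) σ} : ℝ) ≤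
      2 ^ Fintype.card V * Real.exp (-(θ * Fintype.card ι)) *
        ((Fintype.card α).factorial : ℝ) ^ Fintype.card ι := by
  refine le_trans ?_ (card_exists_weightedExcess_gt_le hδ.le hδ' hβ hD s t)
  refine Nat.cast_le.2 (Nat.card_le_card_of_injective
    (Subtype.map id fun σ hσ => ?_) (Subtype.map_injective _ Function.injective_id))
  by_contra hcon
  push Not at hcon
  exact hσ (hasSmallDiscrepancy_of_weightedExcess_le hδ s t σ hcon)

end Discrepancy

/-! ### Moments of Gaussian projections. -/

section Gaussian

open MeasureTheory ProbabilityTheory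

theorem integral_abs_gaussianReal :
    ∫ x, |x| ∂(gaussianReal 0 1) = √(2 / Real.pi) := by
  rw [integral_gaussianReal_eq_integral_smul one_ne_zero]
  have h1 : ∀ x : ℝ, gaussianPDFReal 0 1 x • |x| =
      (fun y => (√(2 * Real.pi))⁻¹ * (y ^ (1 : ℝ) * Real.exp (-(1 / 2) * y ^ (2 : ℝ)))) |x| := by
    intro x
    simp only [gaussianPDFReal, Real.rpow_one, smul_eq_mul]
    rw [Real.rpow_two, sq_abs]
    simp
    ring_nf
  rw [integral_congr_ae (ae_of_all _ h1), integral_comp_abs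
    (f := fun y => (√(2 * Real.pi))⁻¹ * (y ^ (1 : ℝ) * Real.exp (-(1 / 2) * y ^ (2 : ℝ)))),
    integral_const_mul,
    integral_rpow_mul_exp_neg_mul_rpow (by norm_num) (by norm_num) (by norm_num)]
  norm_num
  have h2 : √(2 : ℝ) * √2 = 2 := Real.mul_self_sqrt (by norm_num)
  have h3 : (√2 : ℝ) * (√2)⁻¹ = 1 := mul_inv_cancel₀ (by positivity)
  rw [div_eq_mul_inv]
  linear_combination (-(√Real.pi)⁻¹ * (√2)⁻¹) * h2 + √2 * (√Real.pi)⁻¹ * h3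

variable {E : Type*} [NormedAddCommGroup E] [InnerProductSpace ℝ E] [FiniteDimensional ℝ E]
  [MeasurableSpace E] [BorelSpace E]

theorem map_inner_stdGaussian (a : E) :
    (stdGaussian E).map (fun g => inner ℝ a g) = (gaussianReal 0 1).map (fun x => ‖a‖ * x) := by
  have h := IsGaussian.map_eq_gaussianReal (μ := stdGaussian E) (innerSL ℝ a)
  rw [integral_strongDual_stdGaussian, variance_dual_stdGaussian, innerSL_apply_norm] at h
  rw [gaussianReal_map_const_mul]
  have h1 : Real.toNNReal (‖a‖ ^ 2) = NNReal.mk (‖a‖ ^ 2) (sq_nonneg _) * 1 := by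
    rw [mul_one]
    exact Real.toNNReal_of_nonneg (sq_nonneg _)
  rw [mul_zero, ← h1]
  exact h

theorem integral_comp_inner_stdGaussian (a : E) {f : ℝ → ℝ} (hf : Continuous f) :
    ∫ g, f (inner ℝ a g) ∂(stdGaussian E) = ∫ x, f (‖a‖ * x) ∂(gaussianReal 0 1) := by
  have h1 := integral_map (μ := stdGaussian E) (φ := fun g => inner ℝ a g)
    (by fun_prop) (hf.aestronglyMeasurable (μ := (stdGaussian E).map (fun g => inner ℝ a g)))
  rw [← h1, map_inner_stdGaussian, integral_map (by fun_prop) hf.aestronglyMeasurable]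

theorem memLp_inner_stdGaussian (a : E) (p : ENNReal) (hp : p ≠ ⊤) :
    MemLp (fun g => inner ℝ a g) p (stdGaussian E) := 
  IsGaussian.memLp_dual (stdGaussian E) (innerSL ℝ a) p hp

theorem integral_inner_sq_stdGaussian (a : E) :
    ∫ g, (inner ℝ a g) ^ 2 ∂(stdGaussian E) = ‖a‖ ^ 2 := by
  rw [integral_comp_inner_stdGaussian a (f := fun x => x ^ 2) (by fun_prop)]
  simp only [mul_pow]
  rw [integral_const_mul]
  have := variance_fun_id_gaussianReal (μ := 0) (v := 1)
  rw [variance_eq_integral (by fun_prop), integral_id_gaussianReal] at this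
  simp at this
  rw [this, mul_one]

theorem integral_abs_inner_stdGaussian (a : E) :
    ∫ g, |inner ℝ a g| ∂(stdGaussian E) = ‖a‖ * √(2 / Real.pi) := by
  rw [integral_comp_inner_stdGaussian a (f := fun x => |x|) (by fun_prop)]
  simp only [abs_mul, abs_norm]
  rw [integral_const_mul, integral_abs_gaussianReal]

theorem integral_inner_pow_four_stdGaussian (a : E) :
    ∫ g, (inner ℝ a g) ^ 4 ∂(stdGaussian E) = ‖a‖ ^ 4 * ∫ x, x ^ 4 ∂(gaussianReal 0 1) := by
  rw [integral_comp_inner_stdGaussian a (f := fun x => x ^ 4) (by fun_prop)]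
  simp only [mul_pow]
  rw [integral_const_mul]

theorem indepFun_inner_stdGaussian {a b : E} (hab : inner ℝ a b = 0) :
    IndepFun (fun g => inner ℝ a g) (fun g => inner ℝ b g) (stdGaussian E) := by
  -- The pair is a linear image of g, hence jointly Gaussian, so zero covariance implies
  -- independence.
  have hlaw : HasGaussianLaw (fun g : E => (inner ℝ a g, inner ℝ b g)) (stdGaussian E) := by
    have : HasGaussianLaw (id : E → E) (stdGaussian E) := ⟨by simpa using isGaussian_stdGaussian⟩
    exact this.map ((innerSL ℝ a).prod (innerSL ℝ b))
  refine hlaw.indepFun_of_covariance_eq_zero ?_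
  rw [← covarianceBilin_apply_eq_cov IsGaussian.memLp_two_id, covarianceBilin_stdGaussian,
    innerSL_apply_apply, hab]

theorem integral_abs_inner_mul_abs_inner_stdGaussian {a b : E} (hab : inner ℝ a b = 0) :
    ∫ g, |inner ℝ a g| * |inner ℝ b g| ∂(stdGaussian E) = 2 / Real.pi * (‖a‖ * ‖b‖) := by
  have h := (indepFun_inner_stdGaussian hab).comp (φ := fun x => |x|) (ψ := fun x => |x|)
    (by fun_prop) (by fun_prop)
  have h2 := h.integral_fun_mul_eq_mul_integral (by fun_prop) (by fun_prop)
  simp only [Function.comp_apply] at h2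
  rw [h2, integral_abs_inner_stdGaussian, integral_abs_inner_stdGaussian]
  have := Real.mul_self_sqrt (show 0 ≤ 2 / Real.pi by positivity)
  linear_combination ‖a‖ * ‖b‖ * this

end Gaussian

/-! ### From label sets to real weights by integrating over thresholds. -/

section Threshold

open MeasureTheory ProbabilityTheory

theorem integrable_ite_lt (T c : ℝ) :
    Integrable (fun τ : ℝ => if τ < c then (1 : ℝ) else 0) (volume.restrict (Set.Ioc 0 T)) := by
  have : (fun τ : ℝ => if τ < c then (1 : ℝ) else 0) = (Set.Iio c).indicator 1 := by
    ext τ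
    simp [Set.indicator_apply]
  rw [this]
  exact (integrable_const (1 : ℝ)).indicator measurableSet_Iio

theorem integral_ite_lt {T c : ℝ} (hT : 0 ≤ T) (hc : 0 ≤ c) :
    ∫ τ in Set.Ioc 0 T, (if τ < c then (1 : ℝ) else 0) = min c T := by
  have : (fun τ : ℝ => if τ < c then (1 : ℝ) else 0) = (Set.Iio c).indicator 1 := by
    ext τ
    simp [Set.indicator_apply]
  rw [this, integral_indicator_one measurableSet_Iio, measureReal_restrict_apply measurableSet_Iio]
  rcases le_or_gt c T with h | h
  · have : Set.Iio c ∩ Set.Ioc 0 T = Set.Ioo 0 c := by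
      ext τ
      simp only [Set.mem_inter_iff, Set.mem_Iio, Set.mem_Ioc, Set.mem_Ioo]
      constructor
      · rintro ⟨h1, h2, _⟩; exact ⟨h2, h1⟩
      · rintro ⟨h1, h2⟩; exact ⟨h2, h1, by linarith⟩
    rw [this, Real.volume_real_Ioo_of_le hc, min_eq_left h, sub_zero]
  · have : Set.Iio c ∩ Set.Ioc 0 T = Set.Ioc 0 T := by
      refine Set.inter_eq_right.2 fun τ hτ => ?_
      exact hτ.2.trans_lt h
    rw [this, Real.volume_real_Ioc_of_le hT, min_eq_right h.le, sub_zero]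

theorem min_sq_le_abs_mul_abs (a b T : ℝ) : min (min (a ^ 2) (b ^ 2)) T ≤ |a| * |b| := by
  refine (min_le_left _ _).trans ?_
  rw [← sq_abs a, ← sq_abs b]
  rcases le_total |a| |b| with h | h
  · refine (min_le_left _ _).trans ?_
    nlinarith [abs_nonneg a]
  · refine (min_le_right _ _).trans ?_
    nlinarith [abs_nonneg b]

/-- Write min(a², b²) = (a² + b²)/2 - |a - b||a + b|/2 and bound the last product by 2(a - b)² + (a²
+ b²)/16; truncation at T costs at most a⁴/(4T). -/
theorem le_min_sq {T : ℝ} (hT : 0 < T) (a b : ℝ) :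
    7 / 16 * (a ^ 2 + b ^ 2) - 2 * (a - b) ^ 2 - a ^ 4 / (4 * T) ≤
      min (min (a ^ 2) (b ^ 2)) T := by
  have h4 : a ^ 2 - T ≤ a ^ 4 / (4 * T) := by
    rw [le_div_iff₀ (by positivity)]
    nlinarith [sq_nonneg (a ^ 2 - 2 * T)]
  have h4' : 0 ≤ a ^ 4 / (4 * T) := by positivity
  refine le_min (le_min ?_ ?_) ?_
  · nlinarith [sq_nonneg (9 * a - 7 * b), sq_nonneg (a - b)]
  · nlinarith [sq_nonneg (7 * a - 9 * b), sq_nonneg (a - b)]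
  · nlinarith [sq_nonneg (9 * a - 7 * b), sq_nonneg (a - b)]

variable {α : Type*} [Fintype α] [DecidableEq α] {ι V : Type*} [Fintype ι] [Fintype V]
  [DecidableEq ι] [DecidableEq V]

/-- Layer-cake: the discrepancy bound is applied to {i : τ < y u i ²} and integrated over τ in (0,
T]. The cutoff T keeps the contribution of the additive θ term finite. -/
theorem HasSmallDiscrepancy.sum_min_le {s t : ι → V} {D : ℕ} {γ θ : ℝ} {σ : ι → Equiv.Perm α}
    (h : HasSmallDiscrepancy s t D γ θ σ) (hγ : 0 ≤ γ) {T : ℝ} (hT : 0 ≤ T) (y : V → α → ℝ)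
    (hy : ∀ u i, y u i ≠ 0 → D ≤ multiDegree s t u) :
    ∑ e, ∑ i, min (min (y (s e) i ^ 2) (y (t e) (σ e i) ^ 2)) T ≤
      ∑ e, (∑ i, |y (s e) i|) * (∑ i, |y (t e) i|) / Fintype.card α +
        γ * ∑ e, (∑ i, y (s e) i ^ 2 + ∑ i, y (t e) i ^ 2) + θ * Fintype.card ι * T := by
  set H : ℝ → ℝ → ℝ := fun c τ => if τ < c then (1 : ℝ) else 0 with hH
  have hInt : ∀ c, Integrable (H c) (volume.restrict (Set.Ioc 0 T)) := integrable_ite_lt T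
  have hval : ∀ c, 0 ≤ c → ∫ τ in Set.Ioc 0 T, H c τ = min c T := fun c hc => integral_ite_lt hT hc
  have hmul : ∀ c c' τ, H c τ * H c' τ = H (min c c') τ := by
    intro c c' τ
    simp only [hH, lt_min_iff]
    by_cases h1 : τ < c <;> by_cases h2 : τ < c' <;> simp [h1, h2]
  have hpoint : ∀ τ ∈ Set.Ioc 0 T,
      ∑ e, ∑ i, H (min (y (s e) i ^ 2) (y (t e) (σ e i) ^ 2)) τ ≤
      (∑ e, ∑ i, ∑ j, (Fintype.card α : ℝ)⁻¹ * H (min (y (s e) i ^ 2) (y (t e) j ^ 2)) τ +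
        γ * ∑ e, (∑ i, H (y (s e) i ^ 2) τ + ∑ i, H (y (t e) i ^ 2) τ)) +
        θ * Fintype.card ι := by
    intro τ hτ
    have hcard : ∀ u, ((Finset.univ.filter fun i => τ < y u i ^ 2).card : ℝ) =
        ∑ i, H (y u i ^ 2) τ := fun u => by rw [Finset.sum_boole]
    have := h (fun u => Finset.univ.filter fun i => τ < y u i ^ 2) fun u hu => by
      obtain ⟨i, hi⟩ := hu
      refine hy u i fun h0 => ?_
      have h1 := (Finset.mem_filter.1 hi).2
      rw [h0] at h1
      have := hτ.1
      norm_num at h1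
      linarith
    simp only [hcard] at this
    refine le_trans (le_of_eq ?_) (this.trans (le_of_eq ?_))
    · refine Finset.sum_congr rfl fun e _ => ?_
      rw [matched, Finset.filter_filter, ← Finset.sum_boole]
      refine Finset.sum_congr rfl fun i _ => ?_
      simp [hH]
    · congr 2
      refine Finset.sum_congr rfl fun e _ => ?_
      rw [Finset.sum_mul_sum, Finset.sum_div]
      refine Finset.sum_congr rfl fun i _ => ?_
      rw [Finset.sum_div]
      refine Finset.sum_congr rfl fun j _ => ?_
      rw [hmul, div_eq_inv_mul]
  have hi1 : Integrable (fun τ => ∑ e, ∑ i, H (min (y (s e) i ^ 2) (y (t e) (σ e i) ^ 2)) τ)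
      (volume.restrict (Set.Ioc 0 T)) :=
    integrable_finsetSum _ fun e _ => integrable_finsetSum _ fun i _ => hInt _
  have hi2 : Integrable (fun τ => ∑ e, ∑ i, ∑ j, (Fintype.card α : ℝ)⁻¹ *
      H (min (y (s e) i ^ 2) (y (t e) j ^ 2)) τ) (volume.restrict (Set.Ioc 0 T)) :=
    integrable_finsetSum _ fun e _ => integrable_finsetSum _ fun i _ =>
      integrable_finsetSum _ fun j _ => (hInt _).const_mul _
  have hi3 : ∀ u, Integrable (fun τ => ∑ i, H (y u i ^ 2) τ) (volume.restrict (Set.Ioc 0 T)) :=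
    fun u => integrable_finsetSum _ fun i _ => hInt _
  have hi4 : Integrable (fun τ => ∑ e, (∑ i, H (y (s e) i ^ 2) τ + ∑ i, H (y (t e) i ^ 2) τ))
      (volume.restrict (Set.Ioc 0 T)) :=
    integrable_finsetSum _ fun e _ => (hi3 _).add (hi3 _)
  have hmono := setIntegral_mono_on hi1 ((hi2.add (hi4.const_mul γ)).add
    (integrable_const (θ * Fintype.card ι))) measurableSet_Ioc hpoint
  have hmin : ∀ a b : ℝ, 0 ≤ min (a ^ 2) (b ^ 2) := fun a b => le_min (sq_nonneg a) (sq_nonneg b)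
  have e1 : ∫ τ in Set.Ioc 0 T, ∑ e, ∑ i, H (min (y (s e) i ^ 2) (y (t e) (σ e i) ^ 2)) τ =
      ∑ e, ∑ i, min (min (y (s e) i ^ 2) (y (t e) (σ e i) ^ 2)) T := by
    rw [integral_finsetSum _ fun e _ => integrable_finsetSum _ fun i _ => hInt _]
    refine Finset.sum_congr rfl fun e _ => ?_
    rw [integral_finsetSum _ fun i _ => hInt _]
    exact Finset.sum_congr rfl fun i _ => hval _ (hmin _ _)
  have e2 : ∫ τ in Set.Ioc 0 T, ∑ e, ∑ i, ∑ j, (Fintype.card α : ℝ)⁻¹ *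
      H (min (y (s e) i ^ 2) (y (t e) j ^ 2)) τ ≤
      ∑ e, (∑ i, |y (s e) i|) * (∑ i, |y (t e) i|) / Fintype.card α := by
    rw [integral_finsetSum _ fun e _ => integrable_finsetSum _ fun i _ =>
      integrable_finsetSum _ fun j _ => (hInt _).const_mul _]
    refine Finset.sum_le_sum fun e _ => ?_
    rw [integral_finsetSum _ fun i _ =>
      integrable_finsetSum _ fun j _ => (hInt _).const_mul _, Finset.sum_mul_sum, Finset.sum_div]
    refine Finset.sum_le_sum fun i _ => ?_
    rw [integral_finsetSum _ fun j _ => (hInt _).const_mul _, Finset.sum_div]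
    refine Finset.sum_le_sum fun j _ => ?_
    rw [integral_const_mul, hval _ (hmin _ _), div_eq_inv_mul]
    exact mul_le_mul_of_nonneg_left (min_sq_le_abs_mul_abs _ _ _) (by positivity)
  have e3 : ∀ u, ∫ τ in Set.Ioc 0 T, ∑ i, H (y u i ^ 2) τ ≤ ∑ i, y u i ^ 2 := by
    intro u
    rw [integral_finsetSum _ fun i _ => hInt _]
    refine Finset.sum_le_sum fun i _ => ?_
    rw [hval _ (sq_nonneg _)]
    exact min_le_left _ _
  have e4 : ∫ τ in Set.Ioc 0 T, ∑ e, (∑ i, H (y (s e) i ^ 2) τ + ∑ i, H (y (t e) i ^ 2) τ) ≤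
      ∑ e, (∑ i, y (s e) i ^ 2 + ∑ i, y (t e) i ^ 2) := by
    rw [integral_finsetSum _ fun e _ => by exact (hi3 (s e)).add (hi3 (t e))]
    refine Finset.sum_le_sum fun e _ => ?_
    rw [integral_add (hi3 _) (hi3 _)]
    exact add_le_add (e3 _) (e3 _)
  rw [e1, integral_add' (hi2.add (hi4.const_mul γ)) (integrable_const _),
    integral_add' hi2 (hi4.const_mul γ), integral_const_mul, setIntegral_const,
    Real.volume_real_Ioc_of_le hT, sub_zero, smul_eq_mul, mul_comm T] at hmono
  linarith [mul_le_mul_of_nonneg_left e4 hγ]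

end Threshold

/-! ### Gaussian rounding of an orthogonal vector family. -/

section GaussianRounding

open MeasureTheory ProbabilityTheory

variable {α : Type*} [Fintype α] [DecidableEq α] {ι V : Type*} [Fintype ι] [Fintype V]
  [DecidableEq ι] [DecidableEq V]
  {E : Type*} [NormedAddCommGroup E] [InnerProductSpace ℝ E] [FiniteDimensional ℝ E]
  [MeasurableSpace E] [BorelSpace E]

theorem integrable_inner_sq (a : E) :
    Integrable (fun g => (inner ℝ a g) ^ 2) (stdGaussian E) :=
  (memLp_inner_stdGaussian a 2 (by simp)).integrable_sq

theorem integrable_inner_pow_four (a : E) :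
    Integrable (fun g => (inner ℝ a g) ^ 4) (stdGaussian E) := by
  have := (memLp_inner_stdGaussian a 4 (by simp)).integrable_norm_pow (by norm_num)
  refine this.congr (ae_of_all _ fun g => ?_)
  simp only [Real.norm_eq_abs]
  exact Even.pow_abs ⟨2, rfl⟩ _

theorem integrable_abs_inner_mul_abs_inner (a b : E) :
    Integrable (fun g => |inner ℝ a g| * |inner ℝ b g|) (stdGaussian E) :=
  (memLp_inner_stdGaussian a 2 (by simp)).abs.integrable_mul
    (memLp_inner_stdGaussian b 2 (by simp)).abs

/-- For orthogonal vectors, the second moment of the `ℓ¹` norm of their Gaussian projections is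
smaller by a factor of `2 / π` than for parallel vectors, up to a lower-order term. -/
theorem integral_sq_sum_abs_inner_le {x : α → E} (horth : ∀ i j, i ≠ j → inner ℝ (x i) (x j) = 0)
    (hx : ∑ i, ‖x i‖ ^ 2 ≤ 1) :
    Integrable (fun g => (∑ i, |inner ℝ (x i) g|) ^ 2) (stdGaussian E) ∧
    ∫ g, (∑ i, |inner ℝ (x i) g|) ^ 2 ∂(stdGaussian E) ≤
      1 + 2 / Real.pi * Fintype.card α := by
  have hexp : ∀ g : E, (∑ i, |inner ℝ (x i) g|) ^ 2 =
      ∑ i, ∑ j, |inner ℝ (x i) g| * |inner ℝ (x j) g| := fun g => by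
    rw [sq, Finset.sum_mul_sum]
  simp only [hexp]
  refine ⟨integrable_finsetSum _ fun i _ => integrable_finsetSum _ fun j _ =>
    integrable_abs_inner_mul_abs_inner _ _, ?_⟩
  rw [integral_finsetSum _ fun i _ => integrable_finsetSum _ fun j _ =>
    integrable_abs_inner_mul_abs_inner _ _]
  have hterm : ∀ i j, ∫ g, |inner ℝ (x i) g| * |inner ℝ (x j) g| ∂(stdGaussian E) ≤
      (if i = j then ‖x i‖ ^ 2 else 0) + 2 / Real.pi * (‖x i‖ * ‖x j‖) := by
    intro i j
    split_ifs with hij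
    · subst hij
      have : ∀ g : E, |inner ℝ (x i) g| * |inner ℝ (x i) g| = inner ℝ (x i) g ^ 2 := fun g => by
        rw [← sq, sq_abs]
      simp only [this]
      rw [integral_inner_sq_stdGaussian]
      exact le_add_of_nonneg_right (by positivity)
    · rw [integral_abs_inner_mul_abs_inner_stdGaussian (horth i j hij), zero_add]
  calc ∑ i, ∫ g, ∑ j, |inner ℝ (x i) g| * |inner ℝ (x j) g| ∂(stdGaussian E)
      = ∑ i, ∑ j, ∫ g, |inner ℝ (x i) g| * |inner ℝ (x j) g| ∂(stdGaussian E) :=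
        Finset.sum_congr rfl fun i _ => integral_finsetSum _ fun j _ =>
          integrable_abs_inner_mul_abs_inner _ _
    _ ≤ ∑ i, ∑ j, ((if i = j then ‖x i‖ ^ 2 else 0) + 2 / Real.pi * (‖x i‖ * ‖x j‖)) :=
        Finset.sum_le_sum fun i _ => Finset.sum_le_sum fun j _ => hterm i j
    _ = ∑ i, ‖x i‖ ^ 2 + 2 / Real.pi * (∑ i, ‖x i‖) ^ 2 := by
        rw [sq (∑ i, ‖x i‖), Finset.sum_mul_sum]
        simp [Finset.sum_add_distrib, Finset.mul_sum]
    _ ≤ 1 + 2 / Real.pi * (Fintype.card α * 1) := by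
        refine add_le_add hx (mul_le_mul_of_nonneg_left ?_ (by positivity))
        refine (sq_sum_le_card_mul_sum_sq (s := Finset.univ)).trans ?_
        rw [Finset.card_univ]
        exact mul_le_mul_of_nonneg_left hx (by positivity)
    _ = _ := by rw [mul_one]

theorem integral_lower_bound {a b : α → E} (ha : ∑ i, ‖a i‖ ^ 2 = 1) (hb : ∑ i, ‖b i‖ ^ 2 = 1)
    {T : ℝ} (hT : 0 < T) :
    Integrable (fun g => ∑ i, (7 / 16 * ((inner ℝ (a i) g) ^ 2 + (inner ℝ (b i) g) ^ 2) -
      2 * (inner ℝ (a i) g - inner ℝ (b i) g) ^ 2 - (inner ℝ (a i) g) ^ 4 / (4 * T)))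
      (stdGaussian E) ∧
    7 / 8 - 2 * ∑ i, ‖a i - b i‖ ^ 2 - (∫ x, x ^ 4 ∂(gaussianReal 0 1)) / (4 * T) ≤
      ∫ g, ∑ i, (7 / 16 * ((inner ℝ (a i) g) ^ 2 + (inner ℝ (b i) g) ^ 2) -
        2 * (inner ℝ (a i) g - inner ℝ (b i) g) ^ 2 - (inner ℝ (a i) g) ^ 4 / (4 * T))
        ∂(stdGaussian E) := by
  simp only [← inner_sub_left]
  have hab : ∀ i, Integrable (fun g => 7 / 16 * ((inner ℝ (a i) g) ^ 2 + (inner ℝ (b i) g) ^ 2))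
      (stdGaussian E) :=
    fun i => ((integrable_inner_sq (a i)).add (integrable_inner_sq (b i))).const_mul _
  have hd : ∀ i, Integrable (fun g => 2 * (inner ℝ (a i - b i) g) ^ 2) (stdGaussian E) :=
    fun i => (integrable_inner_sq _).const_mul _
  have h4 : ∀ i, Integrable (fun g => (inner ℝ (a i) g) ^ 4 / (4 * T)) (stdGaussian E) :=
    fun i => (integrable_inner_pow_four _).div_const _
  refine ⟨integrable_finsetSum _ fun i _ => ((hab i).sub (hd i)).sub (h4 i), ?_⟩
  rw [integral_finsetSum _ fun i _ => by exact ((hab i).sub (hd i)).sub (h4 i)]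
  have hval : ∀ i, ∫ g, (7 / 16 * ((inner ℝ (a i) g) ^ 2 + (inner ℝ (b i) g) ^ 2) -
      2 * (inner ℝ (a i - b i) g) ^ 2 - (inner ℝ (a i) g) ^ 4 / (4 * T)) ∂(stdGaussian E) =
      7 / 16 * (‖a i‖ ^ 2 + ‖b i‖ ^ 2) - 2 * ‖a i - b i‖ ^ 2 -
        ‖a i‖ ^ 4 * ((∫ x, x ^ 4 ∂(gaussianReal 0 1)) / (4 * T)) := by
    intro i
    rw [integral_sub (by exact (hab i).sub (hd i)) (h4 i), integral_sub (hab i) (hd i),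
      integral_const_mul, integral_const_mul, integral_div,
      integral_add (integrable_inner_sq _) (integrable_inner_sq _)]
    simp only [integral_inner_sq_stdGaussian, integral_inner_pow_four_stdGaussian]
    ring
  rw [Finset.sum_congr rfl fun i _ => hval i, Finset.sum_sub_distrib, Finset.sum_sub_distrib,
    ← Finset.mul_sum, ← Finset.mul_sum, ← Finset.sum_mul, Finset.sum_add_distrib, ha, hb]
  have hM : 0 ≤ (∫ x, x ^ 4 ∂(gaussianReal 0 1)) / (4 * T) :=
    div_nonneg (integral_nonneg fun x => by positivity) (by positivity)
  have hpow : ∑ i, ‖a i‖ ^ 4 ≤ 1 := by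
    rw [← ha]
    refine Finset.sum_le_sum fun i _ => pow_le_pow_of_le_one (norm_nonneg _) ?_ (by norm_num)
    have : ‖a i‖ ^ 2 ≤ 1 := by
      rw [← ha]
      exact Finset.single_le_sum (f := fun i => ‖a i‖ ^ 2) (fun _ _ => by positivity)
        (Finset.mem_univ i)
    nlinarith [norm_nonneg (a i)]
  nlinarith

/-- An edge of a multigraph both of whose endpoints have degree at least `D`. -/
def IsHighEdge (s t : ι → V) (D : ℕ) (e : ι) : Prop :=
  D ≤ multiDegree s t (s e) ∧ D ≤ multiDegree s t (t e)

-- Every discarded edge has an endpoint of degree below D, and such vertices have total degree at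
-- most D times the number of vertices.
open Classical in
theorem card_le_card_isHighEdge_add (s t : ι → V) (D : ℕ) :
    (Fintype.card ι : ℝ) ≤
      ((Finset.univ.filter (IsHighEdge s t D)).card : ℝ) + D * Fintype.card V := by
  have h := sum_multiDegree_mul s t fun u => if D ≤ multiDegree s t u then 0 else 1
  have h1 : ∑ u, (multiDegree s t u : ℝ) * (if D ≤ multiDegree s t u then 0 else 1) ≤
      D * Fintype.card V := by
    calc _ ≤ ∑ _u : V, (D : ℝ) := by
          refine Finset.sum_le_sum fun u _ => ?_
          split_ifs with hu
          · simp
          · rw [mul_one]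
            exact_mod_cast (not_le.1 hu).le
      _ = _ := by rw [Finset.sum_const, Finset.card_univ, nsmul_eq_mul, mul_comm]
  have h2 : (Fintype.card ι : ℝ) - (Finset.univ.filter (IsHighEdge s t D)).card ≤
      ∑ e, ((if D ≤ multiDegree s t (s e) then (0 : ℝ) else 1) +
        if D ≤ multiDegree s t (t e) then 0 else 1) := by
    rw [← Finset.card_univ, ← Finset.sum_boole, Finset.cast_card, ← Finset.sum_sub_distrib]
    refine Finset.sum_le_sum fun e _ => ?_
    unfold IsHighEdge
    by_cases h1 : D ≤ multiDegree s t (s e) <;> by_cases h2 : D ≤ multiDegree s t (t e) <;>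
      simp [h1, h2]
  linarith

open Classical in
theorem HasSmallDiscrepancy.card_le_sum_norm_sub_sq [Nonempty α] {s t : ι → V} {D : ℕ} {γ θ : ℝ}
    {σ : ι → Equiv.Perm α} (h : HasSmallDiscrepancy s t D γ θ σ) (hγ : 0 ≤ γ) {T : ℝ} (hT : 0 < T)
    {x : V → α → E} (hx : ∀ u, ∑ i, ‖x u i‖ ^ 2 = 1)
    (horth : ∀ u i j, i ≠ j → inner ℝ (x u i) (x u j) = 0) :
    (7 / 8 - (∫ x, x ^ 4 ∂(gaussianReal 0 1)) / (4 * T)) *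
        (Finset.univ.filter (IsHighEdge s t D)).card ≤
      2 * ∑ e, ∑ i, ‖x (s e) i - x (t e) (σ e i)‖ ^ 2 +
        (2 / Real.pi + (Fintype.card α : ℝ)⁻¹ + 2 * γ + θ * T) * Fintype.card ι := by
  set k := Fintype.card α with hk
  have hk0 : (0 : ℝ) < k := by rw [hk]; exact_mod_cast Fintype.card_pos
  set M := (∫ x, x ^ 4 ∂(gaussianReal 0 1)) / (4 * T) with hM
  set P := Finset.univ.filter (IsHighEdge s t D) with hP
  -- Zeroing the low-degree vertices makes all threshold sets admissible for the discrepancy bound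
  -- and leaves high edges unchanged.
  set z : V → α → E := fun u i => if D ≤ multiDegree s t u then x u i else 0 with hz
  have hzs : ∀ u, ∑ i, ‖z u i‖ ^ 2 ≤ 1 := by
    intro u
    by_cases hu : D ≤ multiDegree s t u <;> simp [hz, hu, hx]
  have hzo : ∀ u i j, i ≠ j → inner ℝ (z u i) (z u j) = 0 := by
    intro u i j hij
    by_cases hu : D ≤ multiDegree s t u <;> simp [hz, hu, horth u i j hij]
  set lo : ι → E → ℝ := fun e g => ∑ i, (7 / 16 * ((inner ℝ (x (s e) i) g) ^ 2 +
    (inner ℝ (x (t e) (σ e i)) g) ^ 2) - 2 * (inner ℝ (x (s e) i) g -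
      inner ℝ (x (t e) (σ e i)) g) ^ 2 - (inner ℝ (x (s e) i) g) ^ 4 / (4 * T)) with hlo
  have hlob := fun e => integral_lower_bound (a := x (s e)) (b := fun i => x (t e) (σ e i))
    (hx (s e)) ((Equiv.sum_comp (σ e) fun i => ‖x (t e) i‖ ^ 2).trans (hx (t e))) hT
  set q : V → E → ℝ := fun u g => ∑ i, inner ℝ (z u i) g ^ 2 with hq
  have hqi : ∀ u, Integrable (q u) (stdGaussian E) :=
    fun u => integrable_finsetSum _ fun i _ => integrable_inner_sq _
  have hqv : ∀ u, ∫ g, q u g ∂(stdGaussian E) ≤ 1 := by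
    intro u
    rw [integral_finsetSum _ fun i _ => integrable_inner_sq _]
    simp only [integral_inner_sq_stdGaussian]
    exact hzs u
  set r : V → E → ℝ := fun u g => (∑ i, |inner ℝ (z u i) g|) ^ 2 with hr
  have hrb : ∀ u, Integrable (r u) (stdGaussian E) ∧
      ∫ g, r u g ∂(stdGaussian E) ≤ 1 + 2 / Real.pi * k :=
    fun u => integral_sq_sum_abs_inner_le (hzo u) (hzs u)
  set up : ι → E → ℝ := fun e g => (2 * (k : ℝ))⁻¹ * (r (s e) g + r (t e) g) +
    γ * (q (s e) g + q (t e) g) with hup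
  have hupi : ∀ e, Integrable (up e) (stdGaussian E) := fun e =>
    (((hrb (s e)).1.add (hrb (t e)).1).const_mul _).add (((hqi (s e)).add (hqi (t e))).const_mul _)
  have hpoint : ∀ g, ∑ e ∈ P, lo e g ≤ ∑ e, up e g + θ * Fintype.card ι * T := by
    intro g
    have h1 := h.sum_min_le hγ hT.le (fun u i => inner ℝ (z u i) g) fun u i hne => by
      by_contra hu
      simp [hz, hu] at hne
    have h2 : ∑ e ∈ P, lo e g ≤ ∑ e, ∑ i, min (min (inner ℝ (z (s e) i) g ^ 2)
        (inner ℝ (z (t e) (σ e i)) g ^ 2)) T := by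
      refine le_trans (Finset.sum_le_sum fun e he => ?_)
        (Finset.sum_le_sum_of_subset_of_nonneg (Finset.subset_univ P) fun e _ _ =>
          Finset.sum_nonneg fun i _ => le_min (le_min (sq_nonneg _) (sq_nonneg _)) hT.le)
      obtain ⟨hs, ht⟩ := (Finset.mem_filter.1 he).2
      refine Finset.sum_le_sum fun i _ => ?_
      simp only [hz, hs, ht, if_true]
      exact le_min_sq hT _ _
    refine h2.trans (h1.trans (add_le_add_left ?_ _))
    rw [Finset.mul_sum, ← Finset.sum_add_distrib]
    refine Finset.sum_le_sum fun e _ => add_le_add_left ?_ _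
    -- AM-GM splits the product of the two ℓ¹ norms, so only second moments at a single vertex are
    -- needed.
    rw [div_eq_inv_mul, mul_inv, mul_comm (2 : ℝ)⁻¹, mul_assoc]
    refine mul_le_mul_of_nonneg_left ?_ (by positivity)
    simp only [hr]
    linarith [two_mul_le_add_sq (∑ i, |inner ℝ (z (s e) i) g|) (∑ i, |inner ℝ (z (t e) i) g|)]
  have hint := integral_mono (integrable_finsetSum P fun e _ => (hlob e).1)
    ((integrable_finsetSum Finset.univ fun e _ => hupi e).add
      (integrable_const (θ * Fintype.card ι * T))) hpoint
  rw [integral_finsetSum P fun e _ => (hlob e).1, integral_add'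
    (integrable_finsetSum Finset.univ fun e _ => hupi e) (integrable_const _),
    integral_finsetSum Finset.univ fun e _ => hupi e, integral_const, probReal_univ,
    one_smul] at hint
  have hupv : ∀ e, ∫ g, up e g ∂(stdGaussian E) ≤ (k : ℝ)⁻¹ + 2 / Real.pi + 2 * γ := by
    intro e
    simp only [hup]
    rw [integral_add (by exact ((hrb (s e)).1.add (hrb (t e)).1).const_mul _)
      (by exact ((hqi (s e)).add (hqi (t e))).const_mul _), integral_const_mul, integral_const_mul,
      integral_add (hqi _) (hqi _), integral_add (hrb _).1 (hrb _).1]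
    have h1 := add_le_add (hrb (s e)).2 (hrb (t e)).2
    have h2 := mul_le_mul_of_nonneg_left h1 (by positivity : 0 ≤ (2 * (k : ℝ))⁻¹)
    have h3 : (2 * (k : ℝ))⁻¹ * (1 + 2 / Real.pi * k + (1 + 2 / Real.pi * k)) =
        (k : ℝ)⁻¹ + 2 / Real.pi := by field_simp; ring
    have h4 := mul_le_mul_of_nonneg_left (add_le_add (hqv (s e)) (hqv (t e))) hγ
    linarith
  have h5 := Finset.sum_le_sum fun e (_ : e ∈ Finset.univ) => hupv e
  rw [Finset.sum_const, Finset.card_univ, nsmul_eq_mul] at h5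
  have h6 := Finset.sum_le_sum fun e (_ : e ∈ P) => (hlob e).2
  rw [Finset.sum_sub_distrib, Finset.sum_sub_distrib, ← Finset.mul_sum, Finset.sum_const,
    Finset.sum_const, nsmul_eq_mul, nsmul_eq_mul] at h6
  have h7 : ∑ e ∈ P, ∑ i, ‖x (s e) i - x (t e) (σ e i)‖ ^ 2 ≤
      ∑ e, ∑ i, ‖x (s e) i - x (t e) (σ e i)‖ ^ 2 :=
    Finset.sum_le_sum_of_subset_of_nonneg (Finset.subset_univ P) fun e _ _ =>
      Finset.sum_nonneg fun i _ => by positivity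
  linarith

end GaussianRounding

/-! ### Choice of constants: cheap vectors are exponentially unlikely. -/

section RandomConstraints

open MeasureTheory ProbabilityTheory

/-- The event that some family of vectors with `∑ i, ‖x u i‖ ^ 2 = 1` and orthogonal `x u i` has
average squared distance less than `1 / 16` over the constraints given by `σ`. -/
def HasCheapVectors {n k : ℕ} {ι : Type} [Fintype ι] (s t : ι → Fin n)
    (σ : ι → Equiv.Perm (Fin k)) : Prop :=
  ∃ (d : ℕ) (x : Fin n → Fin k → EuclideanSpace ℝ (Fin d)), (∀ u, ∑ i, ‖x u i‖ ^ 2 = 1) ∧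
    (∀ u i j, i ≠ j → inner ℝ (x u i) (x u j) = 0) ∧
    ∑ e, ∑ i, ‖x (s e) i - x (t e) (σ e i)‖ ^ 2 < (Fintype.card ι : ℝ) / 16

theorem exists_card_hasCheapVectors_le :
    ∃ C : ℝ, 0 < C ∧ ∀ (n k : ℕ) (ι : Type) [Fintype ι] (s t : ι → Fin n), 100 ≤ k →
      C * n ≤ Fintype.card ι →
      (Nat.card {σ : ι → Equiv.Perm (Fin k) // HasCheapVectors s t σ} : ℝ) ≤
        Real.exp (-n) * (k.factorial : ℝ) ^ Fintype.card ι := by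
  classical
  set M : ℝ := ∫ x, x ^ 4 ∂(gaussianReal 0 1) with hM
  have hM0 : 0 ≤ M := integral_nonneg fun x => by positivity
  set T : ℝ := 25 * M + 1 with hTdef
  have hT : 0 < T := by positivity
  -- The first summand is 100 · D with D = 480000, so at most m/100 edges are discarded; the second
  -- gives θm ≥ 2n, which beats the factor 2^n.
  refine ⟨48000000 + 240000 * T, by positivity, fun n k ι _ s t hk hm => ?_⟩
  set m : ℝ := (Fintype.card ι : ℝ) with hmdef
  have : Nonempty (Fin k) := ⟨⟨0, by omega⟩⟩
  set θ : ℝ := 1 / (120000 * T) with hθ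
  have hθ0 : 0 < θ := by positivity
  have hθT : θ * T = 1 / 120000 := by rw [hθ]; field_simp
  have hn0 : (0 : ℝ) ≤ n := by positivity
  have hrand := card_not_hasSmallDiscrepancy_le (α := Fin k) (δ := 1 / 100) (β := 1 / 240000)
    (θ := θ) (D := 480000) (by norm_num) (by norm_num) (by norm_num) (by norm_num) s t
  rw [Fintype.card_fin, Fintype.card_fin] at hrand
  refine le_trans ?_ (hrand.trans ?_)
  · refine Nat.cast_le.2 (Nat.card_le_card_of_injective
      (Subtype.map id fun σ hσ => ?_) (Subtype.map_injective _ Function.injective_id))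
    intro hsmall
    obtain ⟨d, x, hx, horth, hlt⟩ := hσ
    have h1 := hsmall.card_le_sum_norm_sub_sq (by norm_num) hT hx horth
    have h2 := card_le_card_isHighEdge_add s t 480000
    rw [Fintype.card_fin, ← hmdef] at h2
    rw [Fintype.card_fin, ← hM, ← hmdef] at h1
    set p : ℝ := ((Finset.univ.filter (IsHighEdge s t 480000)).card : ℝ) with hp
    simp only [id] at h1
    have hMT : M / (4 * T) ≤ 1 / 100 := by
      rw [div_le_iff₀ (by positivity), hTdef]
      linarith
    have hkinv : (k : ℝ)⁻¹ ≤ 1 / 100 := by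
      rw [one_div]
      exact inv_anti₀ (by norm_num) (by exact_mod_cast hk)
    have hpi : 2 / Real.pi ≤ 0.64 := by
      rw [div_le_iff₀ Real.pi_pos]
      linarith [Real.pi_gt_d2]
    have hp0 : 0 ≤ p := by positivity
    have hm0 : 0 ≤ m := by positivity
    have hTn : 0 ≤ T * n := by positivity
    have hpm : 0.99 * m ≤ p := by
      push_cast at h2
      linarith
    have h3 : 0.865 * p ≤ (7 / 8 - M / (4 * T)) * p :=
      mul_le_mul_of_nonneg_right (by linarith) hp0
    have h4 : (2 / Real.pi + (k : ℝ)⁻¹ + 2 * (1 / 100 / 2 + 12 / (1 / 100) * (1 / 240000)) +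
        12 / (1 / 100) * θ * T) * m ≤ 0.68 * m := by
      refine mul_le_mul_of_nonneg_right ?_ hm0
      rw [mul_assoc, hθT]
      norm_num at hpi hkinv ⊢
      linarith
    -- The gap 0.865 · 0.99 - 0.68 exceeds 1/8, which is twice the assumed bound 1/16.
    linarith
  · refine mul_le_mul_of_nonneg_right ?_ (by positivity)
    have h2 : (2 : ℝ) ^ n ≤ Real.exp n := by
      have : (2 : ℝ) ≤ Real.exp 1 := by linarith [Real.exp_one_gt_d9]
      calc (2 : ℝ) ^ n ≤ Real.exp 1 ^ n := pow_le_pow_left₀ (by norm_num) this n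
        _ = _ := by rw [← Real.exp_nat_mul, mul_one]
    have h3 : 2 * (n : ℝ) ≤ θ * m := by
      have : θ * ((240000 * T) * n) ≤ θ * m :=
        mul_le_mul_of_nonneg_left (by linarith) hθ0.le
      have h4 : θ * ((240000 * T) * n) = 240000 * (θ * T) * n := by ring
      rw [h4, hθT] at this
      linarith
    calc (2 : ℝ) ^ n * Real.exp (-(θ * m)) ≤ Real.exp n * Real.exp (-(θ * m)) :=
          mul_le_mul_of_nonneg_right h2 (Real.exp_pos _).le
      _ ≤ _ := by
          rw [← Real.exp_add, Real.exp_le_exp]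
          linarith

end RandomConstraints

/-! ### Integral solutions, and passage from corrupted edges to the SDP value. -/

namespace UniqueGame

variable {n k : ℕ}

/-- The vectors of an integral solution of the standard SDP. -/
noncomputable def integralVectors (a : Fin n → Fin k) (u : Fin n) (i : Fin k) :
    EuclideanSpace ℝ (Fin 1) :=
  if i = a u then EuclideanSpace.single 0 1 else 0

theorem isSDPFeasible_integralVectors (a : Fin n → Fin k) :
    IsSDPFeasible (integralVectors a) where
  sum_sq u := by
    rw [Finset.sum_eq_single (a u)] <;> simp +contextual [integralVectors]
  orthogonal u i j hij := by
    unfold integralVectors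
    split_ifs with hi hj
    · exact absurd (hi.trans hj.symm) hij
    all_goals simp
  nonneg u v i j _ := by
    unfold integralVectors
    split_ifs <;> simp
  triangle u v w i j l := by
    unfold integralVectors
    split_ifs <;> simp

theorem sum_norm_integralVectors_sub_le (a : Fin n → Fin k) (u v : Fin n)
    (π : Equiv.Perm (Fin k)) :
    ∑ i, ‖integralVectors a u i - integralVectors a v (π i)‖ ^ 2 ≤
      if a v = π (a u) then 0 else 2 := by
  split_ifs with h
  · refine (Finset.sum_eq_zero fun i _ => ?_).le
    by_cases hi : i = a u
    · simp [integralVectors, h, hi]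
    · simp [integralVectors, h, hi]
  · calc _ ≤ ∑ i, ((if i = a u then (1 : ℝ) else 0) + if π i = a v then 1 else 0) := by
          refine Finset.sum_le_sum fun i _ => ?_
          unfold integralVectors
          split_ifs <;> simp
      _ = 2 := by
          rw [Finset.sum_add_distrib, Equiv.sum_comp π fun i => if i = a v then (1 : ℝ) else 0]
          norm_num

theorem sdpObjective_nonneg {E : Type*} [NormedAddCommGroup E] [InnerProductSpace ℝ E]
    (I : UniqueGame n k) (x : Fin n → Fin k → E) : 0 ≤ I.sdpObjective x := by
  unfold sdpObjective
  positivity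

theorem sdpValue_le_sdpObjective (I : UniqueGame n k) {d : ℕ}
    {x : Fin n → Fin k → EuclideanSpace ℝ (Fin d)} (hx : IsSDPFeasible x) :
    I.sdpValue ≤ I.sdpObjective x := by
  refine csInf_le ⟨0, ?_⟩ ⟨d, x, hx, rfl⟩
  rintro _ ⟨d', y, _, rfl⟩
  exact I.sdpObjective_nonneg y

theorem sdpValue_le_of_isSatisfiable (I : UniqueGame n k) {δ : ℝ} (hδ : 0 ≤ δ)
    (h : I.IsSatisfiable (1 - δ)) : I.sdpValue ≤ δ := by
  classical
  obtain ⟨a, ha⟩ := h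
  refine (I.sdpValue_le_sdpObjective (isSDPFeasible_integralVectors a)).trans ?_
  unfold sdpObjective
  rcases Nat.eq_zero_or_pos I.numEdges with h0 | h0
  -- Without edges the factor `1 / (2 * 0)` is 0, so the objective vanishes.
  · simpa [h0] using hδ
  have hpos : (0 : ℝ) < I.numEdges := by exact_mod_cast h0
  rw [one_div, inv_mul_le_iff₀ (by positivity)]
  have hcard : ((Finset.univ : Finset I.graph.edgeSet).card : ℝ) = I.numEdges := by
    rw [numEdges, Finset.card_univ, ← Nat.card_eq_fintype_card, Nat.card_coe_set_eq]
  have hsat : ({e | I.Satisfies a e}.ncard : ℝ) =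
      ((Finset.univ.filter fun e => I.Satisfies a e).card : ℝ) := by
    rw [← Set.ncard_coe_finset]
    simp
  have hsum := Finset.sum_le_sum fun (e : I.graph.edgeSet) (_ : e ∈ Finset.univ) =>
    sum_norm_integralVectors_sub_le a (e : Sym2 (Fin n)).inf (e : Sym2 (Fin n)).sup (I.perm e)
  refine hsum.trans ?_
  have hsplit : ∑ e : I.graph.edgeSet, (if a (e : Sym2 (Fin n)).sup =
      I.perm e (a (e : Sym2 (Fin n)).inf) then (0 : ℝ) else 2) =
      2 * (I.numEdges - ((Finset.univ.filter fun e => I.Satisfies a e).card : ℝ)) := by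
    rw [← hcard, ← Finset.sum_boole, Finset.cast_card, ← Finset.sum_sub_distrib, Finset.mul_sum]
    refine Finset.sum_congr rfl fun e _ => ?_
    unfold Satisfies
    split_ifs <;> norm_num
  rw [hsplit, ← hsat]
  linarith

/-- The smaller endpoints of the edges in `F`. -/
def sourceVertex (I : UniqueGame n k) (F : Finset I.graph.edgeSet) (e : F) : Fin n :=
  ((e : I.graph.edgeSet) : Sym2 (Fin n)).inf

/-- The larger endpoints of the edges in `F`. -/
def targetVertex (I : UniqueGame n k) (F : Finset I.graph.edgeSet) (e : F) : Fin n :=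
  ((e : I.graph.edgeSet) : Sym2 (Fin n)).sup

theorem le_sdpValue_corrupt (I : UniqueGame n k) (F : Finset I.graph.edgeSet) {ε : ℝ}
    (hk : 0 < k) (hE : 0 < I.numEdges) (hF : (F.card : ℝ) = ε * I.numEdges)
    {σ : F → Equiv.Perm (Fin k)}
    (hσ : ¬ HasCheapVectors (I.sourceVertex F) (I.targetVertex F) σ) :
    ε / 32 ≤ (I.corrupt F σ).sdpValue := by
  classical
  have hEpos : (0 : ℝ) < I.numEdges := by exact_mod_cast hE
  -- An integral solution shows that the feasible set is nonempty; this is where a label must exist.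
  refine le_csInf ⟨_, 1, _, isSDPFeasible_integralVectors fun _ => ⟨0, hk⟩, rfl⟩ ?_
  rintro _ ⟨d, x, hx, rfl⟩
  have h1 : (F.card : ℝ) / 16 ≤ ∑ e : F, ∑ i,
      ‖x (I.sourceVertex F e) i - x (I.targetVertex F e) (σ e i)‖ ^ 2 := by
    by_contra hlt
    rw [not_le] at hlt
    refine hσ ⟨d, x, hx.sum_sq, hx.orthogonal, ?_⟩
    rwa [Fintype.card_coe]
  set f : I.graph.edgeSet → ℝ := fun e => ∑ i : Fin k,
    ‖x (e : Sym2 (Fin n)).inf i - x (e : Sym2 (Fin n)).sup ((I.corrupt F σ).perm e i)‖ ^ 2 with hf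
  have h2 : ∑ e : F, ∑ i, ‖x (I.sourceVertex F e) i - x (I.targetVertex F e) (σ e i)‖ ^ 2 =
      ∑ e ∈ F, f e := by
    rw [← Finset.sum_coe_sort F f]
    refine Finset.sum_congr rfl fun e _ => ?_
    have : (I.corrupt F σ).perm (e : I.graph.edgeSet) = σ e := by
      simp [corrupt]
    simp only [hf]
    rw [this]
    rfl
  have h3 : ∑ e ∈ F, f e ≤ ∑ e : I.graph.edgeSet, f e :=
    Finset.sum_le_sum_of_subset_of_nonneg (Finset.subset_univ F) fun e _ _ =>
      Finset.sum_nonneg fun i _ => by positivity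
  have h4 : (I.corrupt F σ).sdpObjective x =
      1 / (2 * (I.numEdges : ℝ)) * ∑ e : I.graph.edgeSet, f e := by
    unfold sdpObjective
    congr 1
  rw [h4, one_div_mul_eq_div, le_div_iff₀ (by positivity)]
  calc ε / 32 * (2 * I.numEdges) = F.card / 16 := by rw [hF]; ring
    _ ≤ _ := h1.trans (h2.le.trans h3)

/-- Uniform probability is a ratio of counts, so bounding the number of bad σ bounds the failure
probability. -/
theorem one_sub_le_probCorrupt (I : UniqueGame n k) (F : Finset I.graph.edgeSet)
    {P : UniqueGame n k → Prop} {Q : (F → Equiv.Perm (Fin k)) → Prop} {c : ℝ}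
    (hQ : ∀ σ, ¬ Q σ → P (I.corrupt F σ))
    (hcard : (Nat.card {σ // Q σ} : ℝ) ≤ c * (k.factorial : ℝ) ^ F.card) :
    1 - c ≤ I.probCorrupt F P := by
  classical
  unfold probCorrupt
  rw [PMF.toOuterMeasure_uniformOfFintype_apply, ENNReal.toReal_div, ENNReal.toReal_natCast,
    ENNReal.toReal_natCast]
  have htot : (Fintype.card (F → Equiv.Perm (Fin k)) : ℝ) = (k.factorial : ℝ) ^ F.card := by
    rw [Fintype.card_fun, Fintype.card_perm, Fintype.card_fin, Fintype.card_coe]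
    push_cast
    rfl
  have hpos : (0 : ℝ) < (k.factorial : ℝ) ^ F.card := by
    have := Nat.factorial_pos k
    positivity
  rw [htot, le_div_iff₀ hpos]
  have hle : Fintype.card (F → Equiv.Perm (Fin k)) ≤
      Nat.card {σ // Q σ} + Fintype.card {σ | P (I.corrupt F σ)} := by
    rw [Nat.card_eq_fintype_card, Fintype.card_subtype, ← Set.toFinset_card, ← Finset.card_univ]
    refine (Finset.card_le_card fun σ _ => ?_).trans (Finset.card_union_le _ _)
    by_cases h : Q σ
    · simp [h]
    · simp [hQ σ h]
  have : (k.factorial : ℝ) ^ F.card ≤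
      Nat.card {σ // Q σ} + (Fintype.card {σ | P (I.corrupt F σ)} : ℝ) := by
    rw [← htot]
    exact_mod_cast hle
  linarith

end UniqueGame

theorem mainTheorem8 :
    (∃ (k₀ : ℕ) (C : ℝ) (η : ℕ → ℝ), 0 < C ∧ Tendsto η atTop (𝓝 0) ∧
      ∀ (n k : ℕ) (ε : ℝ), k₀ ≤ k → 0 < ε → ε ≤ 1 →
        ∀ I : UniqueGame n k,
          C * (n : ℝ) * max ε⁻¹ (Real.log (k : ℝ)) ≤ (I.numEdges : ℝ) →
          ∀ F : Finset I.graph.edgeSet, (F.card : ℝ) = ε * (I.numEdges : ℝ) →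
            1 - η n ≤ I.probCorrupt F (fun J => ε / 32 ≤ J.sdpValue)) ∧
    (∀ (ε δ : ℝ), 0 ≤ δ → δ < ε / 32 →
      ∀ (n k : ℕ) (J : UniqueGame n k), J.IsSatisfiable (1 - δ) →
        J.sdpValue ≤ δ ∧ J.sdpValue < ε / 32) := by
  refine ⟨?_, fun ε δ hδ hδε n k J hJ => ?_⟩
  · obtain ⟨C, hC, hcheap⟩ := exists_card_hasCheapVectors_le
    refine ⟨100, C, fun n => Real.exp (-n), hC,
      Real.tendsto_exp_neg_atTop_nhds_zero.comp tendsto_natCast_atTop_atTop,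
      fun n k ε hk hε _ I hE F hF => ?_⟩
    rcases Nat.eq_zero_or_pos n with rfl | hn
    -- For n = 0 the error `exp (-0)` is 1, so the bound is vacuous.
    · simp [UniqueGame.probCorrupt]
    have hn' : (0 : ℝ) < n := by exact_mod_cast hn
    have hE' : C * n * ε⁻¹ ≤ I.numEdges :=
      (mul_le_mul_of_nonneg_left (le_max_left _ _) (by positivity)).trans hE
    have hEpos : 0 < I.numEdges := by
      have : (0 : ℝ) < I.numEdges := lt_of_lt_of_le (by positivity) hE'
      exact_mod_cast this
    have hFn : C * n ≤ F.card := by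
      rw [hF, mul_comm ε]
      rwa [← div_eq_mul_inv, div_le_iff₀ hε] at hE'
    refine I.one_sub_le_probCorrupt F
      (fun σ hσ => I.le_sdpValue_corrupt F (by omega) hEpos hF hσ) ?_
    have := hcheap n k F (I.sourceVertex F) (I.targetVertex F) hk (by rwa [Fintype.card_coe])
    rwa [Fintype.card_coe] at this
  · have := J.sdpValue_le_of_isSatisfiable hδ hJ
    exact ⟨this, this.trans_lt hδε⟩
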